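/- **Setting.** Let $\mathcal T\in\mathbb R^{I_1\times I_2\times I_3}$ be a tensor, $\Omega$ a set of index triples, $L_n=D_n-W_n$ $(n=1,2,3)$ with $W_n\in\mathbb R^{I_n\times I_n}$ a weight matrix and $D_n$ diagonal, $(D_n)_{ii}=\sum_j (W_n)_{ij}$; let $\lambda>0$, $\mu\ge 0$, and let $d_1,d_2,d_3$ be given. Write $\mathcal G_{(n)}$ for the mode-$n$ unfolding, $\mathrm{refold}$ for its inverse, $\|\cdot\|_*$ for the trace norm of a matrix and $\|\mathcal G\|_*=\frac13\sum_n\|\mathcal G_{(n)}\|_*$, and $h(U,V,W)=\mathrm{Tr}(U^TL_1U)+\mathrm{Tr}(V^TL_2V)+\mathrm{Tr}(W^TL_3W)$. The graph-Laplacian-regularized (GROID) model is $$\min_{\mathcal G,U,V,W,\mathcal X}\ \tfrac1\lambda\|\mathcal G\|_*+\tfrac12\|\mathcal X-\mathcal G\times_1U\times_2V\times_3W\|_F^2+\tfrac\mu2h(U,V,W)\quad\text{s.t. } \mathcal X_\Omega=\mathcal T_\Omega,\ U^TU=I,\ V^TV=I,\ W^TW=I ,$$ with $\mathcal G\in\mathbb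 R^{d_1\times d_2\times d_3}$, split by auxiliary matrices $G_n=\mathcal G_{(n)}$. **Algorithm 2.** Let $\gamma>1$. From arbitrary initial values and $\rho^0,\rho^1>0$, for $k=0,1,\dots$: 1. $G_n^{k+1}=\mathrm{SVT}_{1/(3\lambda\rho^k)}(\mathcal G^k_{(n)}+Y_n^k/\rho^k)$, where $\mathrm{SVT}_t$ replaces each singular value $\sigma$ by $\max(\sigma-t,0)$. Put $\mathcal B=\sum_n\mathrm{refold}(G_n^{k+1}-Y_n^k/\rho^k)$ and $$\mathcal F(U,V,W)=-\frac{\|\mathcal X^k\times_1U^T\times_2V^T\times_3W^T+\rho^k\mathcal B\|_F^2}{2(1+3\rho^k)}+\frac\mu2h(U,V,W).$$ 2. Update $U,V,W$ successively, each time with the latest values of the other two factors. For $U$: let $\tau^k_1>0$ be a constant for which $U\mapsto\nabla\mathcal F(U,V^k,W^k)$ is Lipschitz on $\mathbb R^{I_1\times d_1}$ (Frobenius norms), and let $U^{k+1}=\mathrm{ORT}\big(\mathcal F_1(U^k)+\mathcal F_2(U^k)+Q+(1+3\rho^k)\tau_1^kU^k\big)$, where $\mathrm{ORT}(A)=\widehat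 U\widehat V^T$ for a thin singular value decomposition $A=\widehat U\Sigma\widehat V^T$ (any one, if $A$ does not have full column rank), $M=(\mathcal X^k\times_2(V^k)^T\times_3(W^k)^T)_{(1)}$, $Q=\rho^kM\mathcal B_{(1)}^T$, $\mathcal F_1(U^k)=\frac12[MM^T-\mu(1+3\rho^k)L_1]U^k$ and $\mathcal F_2(U^k)=\frac12[MM^T-\mu(1+3\rho^k)L_1]^TU^k$; that is, $U^{k+1}$ minimizes $\langle\nabla\mathcal F(U^k,V^k,W^k),U-U^k\rangle+\frac{\tau_1^k}2\|U-U^k\|_F^2$ subject to $U^TU=I$. Likewise for $V$ and $W$ with constants $\tau_2^k,\tau_3^k$. 3. $\mathcal G^{k+1}=\frac1{1+3\rho^k}\big(\rho^k\mathcal B+\mathcal X^k\times_1(U^{k+1})^T\times_2(V^{k+1})^T\times_3(W^{k+1})^T\big)$. 4. $\mathcal X^{k+1}$ equals $\mathcal T$ on $\Omega$ and $\mathcal G^{k+1}\times_1U^{k+1}\times_2V^{k+1}\times_3W^{k+1}$ off $\Omega$. 5. $Y_n^{k+1}=Y_n^k+\rho^k(\mathcal G^{k+1}_{(n)}-G_n^{k+1})$.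 6. For $k\ge1$, $\rho^{k+1}=\gamma\rho^k$ if $r^k>10s^k$, $\rho^{k+1}=\rho^k/\gamma$ if $s^k>10r^k$, and $\rho^{k+1}=\rho^k$ otherwise, where $r^k=\max_n\|\mathcal G^k_{(n)}-G^k_n\|_F$ and $s^k=\rho^{k-1}\max\big(\|\mathcal G^k-\mathcal G^{k-1}\|_F,\ \|(\mathcal X^k-\mathcal X^{k-1})\times_1(U^k)^T\times_2(V^k)^T\times_3(W^k)^T\|_F\big)$. **Theorem.** Let $(\{G_n^k\},\mathcal G^k,U^k,V^k,W^k,\mathcal X^k,\{Y_n^k\})$ be a sequence generated by Algorithm 2 whose penalty parameters $\rho^k$ are bounded away from $0$. Suppose that the sequences $\{Y_n^k\}_k$ $(n=1,2,3)$ are bounded and $\sum_{k=0}^\infty\|Y_n^{k+1}-Y_n^k\|_F<\infty$. Then any accumulation point $(\{G_n\},\mathcal G,U,V,W,\mathcal X)$ of $\{(\{G_n^k\},\mathcal G^k,U^k,V^k,W^k,\mathcal X^k)\}$ satisfies the KKT conditions: $\mathcal X_\Omega=\mathcal T_\Omega$, $G_n=\mathcal G_{(n)}$, $U^TU=I$,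 $V^TV=I$, $W^TW=I$, $\mathcal X_{\Omega^c}=(\mathcal G\times_1U\times_2V\times_3W)_{\Omega^c}$, and there are matrices $Y_1,Y_2,Y_3$ with $$Y_n\in\partial\big(\|\cdot\|_*/(3\lambda)\big)(G_n)\ (n=1,2,3),\qquad \mathcal G-\mathcal X\times_1U^T\times_2V^T\times_3W^T+\sum_{n=1}^3\mathrm{refold}(Y_n)=0 .$$ If moreover the constants $\tau_n^k$ are bounded and, for some $\varepsilon>0$, all $\tau_n^k-\varepsilon$ are still Lipschitz constants of the respective gradients, then the point is also stationary in $U$, $V$ and $W$: the gradient of the objective with respect to $U$ equals $-U\Lambda$ for some symmetric matrix $\Lambda$, and likewise for $V$ and $W$. -/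

import Mathlib

open Filter

noncomputable section

namespace Groid

/-! ### Third-order tensors, unfoldings, multilinear products

The three modes are indexed by `Fin 3`, and `d n` is the size of mode `n`.  A family of factor
matrices `U : Factors I d` stands for the triple `(U, V, W) = (U 0, U 1, U 2)`. -/

/-- Multi-indices of a third-order tensor of size `d 0 × d 1 × d 2`. -/
abbrev Idx (d : Fin 3 → ℕ) := ∀ n, Fin (d n)

/-- Real third-order tensors of size `d 0 × d 1 × d 2`. -/
abbrev Tensor (d : Fin 3 → ℕ) := Idx d → ℝ

/-- Column indices of the mode-`n` unfolding: the indices of the two remaining modes.  (They are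
kept as pairs instead of being numbered consecutively; the numbering only permutes columns.) -/
abbrev ColIdx (d : Fin 3 → ℕ) (n : Fin 3) := ∀ j : {j : Fin 3 // j ≠ n}, Fin (d j)

/-- Matrices of the shape of a mode-`n` unfolding. -/
abbrev Unf (d : Fin 3 → ℕ) (n : Fin 3) := Matrix (Fin (d n)) (ColIdx d n) ℝ

/-- Triples of factor matrices of sizes `I n × d n`. -/
abbrev Factors (I d : Fin 3 → ℕ) := ∀ n, Matrix (Fin (I n)) (Fin (d n)) ℝ

variable {I d : Fin 3 → ℕ}

/-- The mode-`n` unfolding of a tensor. -/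
def unfold (n : Fin 3) (G : Tensor d) : Unf d n :=
  Matrix.of fun i c => G ((Equiv.piSplitAt n fun j => Fin (d j)).symm (i, c))

/-- The tensor whose mode-`n` unfolding is the given matrix. -/
def refold (n : Fin 3) (M : Unf d n) : Tensor d :=
  fun i => M (i n) fun j => i j

theorem unfold_refold (n : Fin 3) (M : Unf d n) : unfold n (refold n M) = M := by
  ext i c
  have h := (Equiv.piSplitAt n fun j => Fin (d j)).apply_symm_apply (i, c)
  have h1 := congrArg Prod.fst h
  have h2 := congrArg Prod.snd h
  simp only [Equiv.piSplitAt, Equiv.coe_fn_mk] at h1 h2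
  change M _ _ = M i c
  exact congrArg₂ M h1 h2

theorem refold_unfold (n : Fin 3) (G : Tensor d) : refold n (unfold n G) = G := by
  funext i
  exact congrArg G ((Equiv.piSplitAt n fun j => Fin (d j)).symm_apply_apply i)

/-- The product `G ×₁ U ×₂ V ×₃ W`. -/
def multiProd (G : Tensor d) (U : Factors I d) : Tensor I :=
  fun i => ∑ j : Idx d, G j * ∏ n, U n (i n) (j n)

/-- The product `X ×₁ Uᵀ ×₂ Vᵀ ×₃ Wᵀ`. -/
def multiProdT (X : Tensor I) (U : Factors I d) : Tensor d :=
  multiProd X fun n => (U n).transpose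

/-- The matrix with `(G ×₁ U ×₂ V ×₃ W)₍ₙ₎ = U n * G₍ₙ₎ * (kron n U)ᵀ`: the Kronecker product of
the two factors of the modes different from `n`. -/
def kron (n : Fin 3) (U : Factors I d) : Matrix (ColIdx I n) (ColIdx d n) ℝ :=
  Matrix.of fun a c => ∏ j : {j : Fin 3 // j ≠ n}, U j (a j) (c j)

/-- The mode-`n` unfolding of the product of `X` with the transposed factors of the two modes
different from `n`. -/
def partialProj (n : Fin 3) (X : Tensor I) (U : Factors I d) :
    Matrix (Fin (I n)) (ColIdx d n) ℝ :=
  unfold n X * kron n U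

/-! ### Norms -/

/-- Frobenius norm of a tensor. -/
def tensorNorm (X : Tensor d) : ℝ := √(∑ i, X i ^ 2)

/-- Frobenius norm of a matrix. -/
def frobNorm {m n : Type*} [Fintype m] [Fintype n] (M : Matrix m n ℝ) : ℝ :=
  √(∑ i, ∑ j, M i j ^ 2)

/-- Inner product of two matrices. -/
def frobInner {m n : Type*} [Fintype m] [Fintype n] (A B : Matrix m n ℝ) : ℝ :=
  ∑ i, ∑ j, A i j * B i j

/-- Trace norm (nuclear norm) of a matrix: the sum of its singular values. -/
def traceNorm {m n : Type*} [Fintype m] [Fintype n] [DecidableEq n] (M : Matrix m n ℝ) : ℝ :=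
  (Matrix.toEuclideanLin M).singularValues.sum fun _ s => s

/-- `Y ∈ ∂ f(G)`: `Y` is a subgradient at `G` of the function `f` on matrices. -/
def IsSubgradient {m n : Type*} [Fintype m] [Fintype n] (f : Matrix m n ℝ → ℝ)
    (G Y : Matrix m n ℝ) : Prop :=
  ∀ Z : Matrix m n ℝ, f G + frobInner Y (Z - G) ≤ f Z

/-! ### Singular value thresholding and orthonormalization -/

/-- `Z = SVT_t(M)`: for a singular value decomposition `M = P diag(σ) Rᵀ`,
`Z = P diag(max(σ - t, 0)) Rᵀ`. -/
def IsSVT {m n : Type*} [Fintype m] [Fintype n]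
    (t : ℝ) (M Z : Matrix m n ℝ) : Prop :=
  ∃ (r : ℕ) (P : Matrix m (Fin r) ℝ) (σ : Fin r → ℝ) (R : Matrix n (Fin r) ℝ),
    P.transpose * P = 1 ∧ R.transpose * R = 1 ∧ (∀ i, 0 ≤ σ i) ∧
    M = P * Matrix.diagonal σ * R.transpose ∧
    Z = P * Matrix.diagonal (fun i => max (σ i - t) 0) * R.transpose

/-- `Q = ORT(A)`: for a singular value decomposition `A = P diag(σ) Rᵀ`, with `P` of the same size
as `A` and having orthonormal columns and `R` orthogonal, `Q = P Rᵀ`.  If `A` does not have full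
column rank, then every choice of the decomposition is allowed. -/
def IsORT {m n : Type*} [Fintype m] [Fintype n] [DecidableEq n]
    (A Q : Matrix m n ℝ) : Prop :=
  ∃ (P : Matrix m n ℝ) (σ : n → ℝ) (R : Matrix n n ℝ),
    P.transpose * P = 1 ∧ R.transpose * R = 1 ∧ (∀ i, 0 ≤ σ i) ∧
    A = P * Matrix.diagonal σ * R.transpose ∧ Q = P * R.transpose

/-! ### The graph regularized model -/

/-- The data of the model: observed entries `T_Ω`, weight matrices of the three graphs, and the
regularization parameters. -/
structure Problem (I : Fin 3 → ℕ) where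
  /-- the tensor `𝒯`, of which only the entries in `Ω` are used -/
  T : Tensor I
  /-- the set of observed entries -/
  Ω : Finset (Idx I)
  /-- the weight matrices of the three graphs -/
  weight : ∀ n, Matrix (Fin (I n)) (Fin (I n)) ℝ
  /-- the parameter `λ` -/
  lam : ℝ
  /-- the parameter `μ` -/
  mu : ℝ

/-- The graph Laplacian `Lₙ = Dₙ - Wₙ`. -/
def Problem.lap (P : Problem I) (n : Fin 3) : Matrix (Fin (I n)) (Fin (I n)) ℝ :=
  Matrix.diagonal (fun i => ∑ j, P.weight n i j) - P.weight n

/-- The function `h(U,V,W) = Tr(Uᵀ L₁ U) + Tr(Vᵀ L₂ V) + Tr(Wᵀ L₃ W)`. -/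
def Problem.h (P : Problem I) (U : Factors I d) : ℝ :=
  ∑ n, Matrix.trace ((U n).transpose * P.lap n * U n)

/-- The primal variables `({Gₙ}, 𝒢, (U, V, W), 𝒳)`. -/
abbrev Primal (I d : Fin 3 → ℕ) :=
  (∀ n, Unf d n) × Tensor d × Factors I d × Tensor I

/-- The Karush-Kuhn-Tucker system of the model
`min (1/λ)‖𝒢‖_* + ½‖𝒳 - 𝒢 ×₁ U ×₂ V ×₃ W‖² + (μ/2) h(U,V,W)` subject to `𝒳_Ω = 𝒯_Ω` and
`UᵀU = I`, `VᵀV = I`, `WᵀW = I`, with the splitting `𝒢₍ₙ₎ = Gₙ`: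
primal feasibility and dual feasibility with respect to `{Gₙ}`, `𝒢` and `𝒳`. -/
def IsKKT (P : Problem I) (p : Primal I d) : Prop :=
  match p with
  | (G, C, U, X) =>
    (∀ i ∈ P.Ω, X i = P.T i) ∧
    (∀ n, G n = unfold n C) ∧
    (∀ n, (U n).transpose * U n = 1) ∧
    (∀ i ∉ P.Ω, X i = multiProd C U i) ∧
    ∃ Y : ∀ n, Unf d n,
      (∀ n, IsSubgradient (fun Z => traceNorm Z / (3 * P.lam)) (G n) (Y n)) ∧
      C - multiProdT X U + ∑ n, refold n (Y n) = 0

/-- Stationarity with respect to the factor of mode `n`: the gradient of the objective in that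
factor plus `U n * Λ` vanishes for a symmetric multiplier `Λ` of `(U n)ᵀ U n = I`. -/
def IsFactorStationary (P : Problem I) (p : Primal I d) (n : Fin 3) : Prop :=
  match p with
  | (_, C, U, X) =>
    ∃ Λ : Matrix (Fin (d n)) (Fin (d n)) ℝ, Λ.transpose = Λ ∧
      -(unfold n (X - multiProd C U) * kron n U * (unfold n C).transpose)
        + (P.mu / 2) • ((P.lap n + (P.lap n).transpose) * U n) + U n * Λ = 0

/-! ### The linearized alternating direction method -/

/-- The variables of one iteration: `Gₙ`, the core tensor `𝒢`, the factors `(U, V, W)`, `𝒳`, the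
multipliers `Yₙ` and the penalty parameter `ρ`. -/
structure Iterate (I d : Fin 3 → ℕ) where
  G : ∀ n, Unf d n
  core : Tensor d
  U : Factors I d
  X : Tensor I
  Y : ∀ n, Unf d n
  rho : ℝ

/-- The primal variables of an iterate. -/
def Iterate.primal (z : Iterate I d) : Primal I d := (z.G, z.core, z.U, z.X)

/-- `ℬ = ∑ₙ refold(Gₙ - Yₙ/ρ)`. -/
def calB (ρ : ℝ) (G Y : ∀ n, Unf d n) : Tensor d :=
  ∑ n, refold n (G n - ρ⁻¹ • Y n)

/-- `ℱ(U,V,W) = -‖𝒜 + ρℬ‖² / (2(1+3ρ)) + (μ/2) h(U,V,W)` with `𝒜 = 𝒳 ×₁ Uᵀ ×₂ Vᵀ ×₃ Wᵀ`. -/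
def factorCost (P : Problem I) (ρ : ℝ) (X : Tensor I) (B : Tensor d) (U : Factors I d) : ℝ :=
  -(tensorNorm (multiProdT X U + ρ • B) ^ 2) / (2 * (1 + 3 * ρ)) + P.mu / 2 * P.h U

/-- The gradient (matrix of partial derivatives) of `ℱ` as a function of the factor of mode `n`,
evaluated at the matrix `A`; the two other factors are those of `U`. -/
def factorGrad (P : Problem I) (ρ : ℝ) (X : Tensor I) (B : Tensor d) (U : Factors I d)
    (n : Fin 3) (A : Matrix (Fin (I n)) (Fin (d n)) ℝ) : Matrix (Fin (I n)) (Fin (d n)) ℝ :=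
  Matrix.of fun i j =>
    deriv (fun t : ℝ =>
      factorCost P ρ X B (Function.update U n (A + t • Matrix.single i j (1 : ℝ)))) 0

/-- The factors in use when the factor of mode `n` is updated: the modes before `n` have been
updated already. -/
def currentFactors (n : Fin 3) (U U' : Factors I d) : Factors I d :=
  fun m => if m < n then U' m else U m

/-- In the step from `z` to `z'`, the gradient of `ℱ` with respect to the factor of mode `n` is
Lipschitz continuous with constant `t`. -/
def GradLipschitz (P : Problem I) (z z' : Iterate I d) (n : Fin 3) (t : ℝ) : Prop :=
  ∀ A A' : Matrix (Fin (I n)) (Fin (d n)) ℝ,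
    frobNorm
      (factorGrad P z.rho z.X (calB z.rho z'.G z.Y) (currentFactors n z.U z'.U) n A -
        factorGrad P z.rho z.X (calB z.rho z'.G z.Y) (currentFactors n z.U z'.U) n A')
      ≤ t * frobNorm (A - A')

/-- The matrix `ℱ₁(U) + ℱ₂(U) + Q + (1+3ρ) τ U`, with `U` the old factor of mode `n`.  It is
`1+3ρ` times `τ U - ∇ℱ(U)`, so its `ORT` minimizes the linearization
`⟨∇ℱ(U), Z - U⟩ + (τ/2)‖Z - U‖²` over the `Z` with orthonormal columns. -/
def ortArg (P : Problem I) (z z' : Iterate I d) (n : Fin 3) (τ : ℝ) :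
    Matrix (Fin (I n)) (Fin (d n)) ℝ :=
  let M := partialProj n z.X (currentFactors n z.U z'.U)
  let S := M * M.transpose - (P.mu * (1 + 3 * z.rho)) • P.lap n
  (1 / 2 : ℝ) • (S * z.U n) + (1 / 2 : ℝ) • (S.transpose * z.U n)
    + z.rho • (M * (unfold n (calB z.rho z'.G z.Y)).transpose)
    + ((1 + 3 * z.rho) * τ) • z.U n

/-- One iteration, from `z` to `z'`, with the constants `τ n` in the updates of the factors. -/
structure IsStep (P : Problem I) (z z' : Iterate I d) (τ : Fin 3 → ℝ) : Prop where
  G_update : ∀ n, IsSVT (1 / (3 * P.lam * z.rho)) (unfold n z.core + z.rho⁻¹ • z.Y n) (z'.G n)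
  tau_pos : ∀ n, 0 < τ n
  tau_lipschitz : ∀ n, GradLipschitz P z z' n (τ n)
  U_update : ∀ n, IsORT (ortArg P z z' n (τ n)) (z'.U n)
  core_update : z'.core =
    (1 + 3 * z.rho)⁻¹ • (z.rho • calB z.rho z'.G z.Y + multiProdT z.X z'.U)
  X_update : z'.X = fun i => if i ∈ P.Ω then P.T i else multiProd z'.core z'.U i
  Y_update : ∀ n, z'.Y n = z.Y n + z.rho • (unfold n z'.core - z'.G n)

/-- Primal residual. -/
def primalRes (z : Iterate I d) : ℝ :=
  max (frobNorm (unfold 0 z.core - z.G 0))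
    (max (frobNorm (unfold 1 z.core - z.G 1)) (frobNorm (unfold 2 z.core - z.G 2)))

/-- Dual residual of the step from `z` to `z'`. -/
def dualRes (z z' : Iterate I d) : ℝ :=
  max (z.rho * tensorNorm (z'.core - z.core))
    (z.rho * tensorNorm (multiProdT (z'.X - z.X) z'.U))

/-- The adaptive rule for the penalty parameter. -/
def nextRho (γ ρ r s : ℝ) : ℝ :=
  if 10 * s < r then γ * ρ else if 10 * r < s then ρ / γ else ρ

/-- `z` is generated by the linearized alternating direction method with constants `τ`.  The
residuals `rᵏ` and `sᵏ` exist for `k ≥ 1` only, so the rule for `ρᵏ⁺¹` is imposed from `k = 1` on,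
and `ρ⁰` and `ρ¹` are arbitrary positive numbers. -/
structure IsAlgorithm2 (P : Problem I) (γ : ℝ) (z : ℕ → Iterate I d) (τ : ℕ → Fin 3 → ℝ) :
    Prop where
  rho_pos : ∀ k, 0 < (z k).rho
  step : ∀ k, IsStep P (z k) (z (k + 1)) (τ k)
  rho_update : ∀ k, (z (k + 2)).rho =
    nextRho γ (z (k + 1)).rho (primalRes (z (k + 1))) (dualRes (z k) (z (k + 1)))

end Groid

end

/-!
Accumulation points of the linearized alternating direction method are KKT points.

*Multipliers.* The update of `Yₙ` makes the residual `𝒢₍ₙ₎ - Gₙ` equal to the change of `Yₙ` divided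
by `ρ`; since `ρ` is bounded away from zero and the changes are summable, the residuals tend to zero
and the multipliers converge.  Singular value thresholding is the proximal map of the trace norm, so
that `Yₙᵏ⁺¹ + Dᵏ₍ₙ₎` is a subgradient at `Gₙᵏ⁺¹`, where `Dᵏ = ρᵏ(𝒢ᵏ - 𝒢ᵏ⁺¹)` is `dualGap`.  What is
needed about the trace norm is its dual description as the maximum of `⟨K, ·⟩` over the matrices `K`
of spectral norm at most one (`IsContraction.frobInner_le_traceNorm`,
`exists_contraction_frobInner_eq`).

*The dual gap tends to zero* (`IsAlgorithm2.tendsto_dualGap`), even though `ρᵏ` need not be bounded.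
Comparing the subgradients of two consecutive iterations, monotonicity of the subdifferential gives
`‖Dᵏ⁺¹‖² ≤ ‖Dᵏ‖²` up to summable errors, so `‖Dᵏ‖` converges.  If the limit were positive, the dual
residual, which is at least `‖Dᵏ‖`, would exceed ten times the vanishing primal residual from some
point on, and the penalty rule would divide `ρ` by `γ` forever, against the lower bound on `ρ`.

*The augmented Lagrangian decreases up to summable errors* (`IsStep.augLagrangian_le`).  With
orthonormal factors, eliminating the core tensor turns it into `factorCost`, which is quadratic in
each factor; the orthonormalization minimizes a quadratic majorant of it.  As the Lagrangian is
bounded below, successive differences of `𝒳` tend to zero, and so do those of the factors if the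
Lipschitz constants have a margin `ε`.

The optimality condition of the core update, `𝒢ᵏ⁺¹ - 𝒳ᵏ ×₁ Uᵀ ×₂ Vᵀ ×₃ Wᵀ + ∑ refold Yₙᵏ⁺¹ = 0` with
the new factors (`IsStep.core_stationary`), and the subgradient relation then pass to the limit.  For
the factors, the polar decomposition `A = U' S` with symmetric `S = U'ᵀ A` of the matrix `A` whose
orthonormalization is `U'` passes to the limit as well and yields the symmetric multiplier.
-/

open scoped Topology Matrix

namespace Groid

/-! ### The Frobenius inner product -/

section Frobenius

variable {m n r : Type*} [Fintype m] [Fintype n] [Fintype r]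

theorem frobInner_eq_trace (A B : Matrix m n ℝ) : frobInner A B = (Aᵀ * B).trace := by
  simp only [frobInner, Matrix.trace, Matrix.diag, Matrix.mul_apply, Matrix.transpose_apply]
  exact Finset.sum_comm

theorem frobInner_comm (A B : Matrix m n ℝ) : frobInner A B = frobInner B A := by
  simp only [frobInner, mul_comm]

theorem frobInner_add_left (A B C : Matrix m n ℝ) :
    frobInner (A + B) C = frobInner A C + frobInner B C := by
  simp only [frobInner, Matrix.add_apply, add_mul, Finset.sum_add_distrib]

theorem frobInner_sub_left (A B C : Matrix m n ℝ) :
    frobInner (A - B) C = frobInner A C - frobInner B C := by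
  simp only [frobInner, Matrix.sub_apply, sub_mul, Finset.sum_sub_distrib]

theorem frobInner_neg_left (A B : Matrix m n ℝ) : frobInner (-A) B = -frobInner A B := by
  simp only [frobInner, Matrix.neg_apply, neg_mul, Finset.sum_neg_distrib]

theorem frobInner_smul_left (c : ℝ) (A B : Matrix m n ℝ) :
    frobInner (c • A) B = c * frobInner A B := by
  simp only [frobInner, Matrix.smul_apply, smul_eq_mul, Finset.mul_sum, mul_assoc]

theorem frobInner_add_right (A B C : Matrix m n ℝ) :
    frobInner A (B + C) = frobInner A B + frobInner A C := by
  simp only [frobInner_comm A, frobInner_add_left]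

theorem frobInner_sub_right (A B C : Matrix m n ℝ) :
    frobInner A (B - C) = frobInner A B - frobInner A C := by
  simp only [frobInner_comm A, frobInner_sub_left]

theorem frobInner_smul_right (c : ℝ) (A B : Matrix m n ℝ) :
    frobInner A (c • B) = c * frobInner A B := by
  simp only [frobInner_comm A, frobInner_smul_left]

theorem frobInner_self_nonneg (A : Matrix m n ℝ) : 0 ≤ frobInner A A :=
  Finset.sum_nonneg fun _ _ => Finset.sum_nonneg fun _ _ => mul_self_nonneg _

theorem frobNorm_nonneg (A : Matrix m n ℝ) : 0 ≤ frobNorm A := Real.sqrt_nonneg _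

theorem frobNorm_sq (A : Matrix m n ℝ) : frobNorm A ^ 2 = frobInner A A := by
  have h : frobInner A A = ∑ i, ∑ j, A i j ^ 2 := by simp only [frobInner, sq]
  rw [frobNorm, ← h, Real.sq_sqrt (frobInner_self_nonneg A)]

theorem frobInner_le (A B : Matrix m n ℝ) : frobInner A B ≤ frobNorm A * frobNorm B := by
  refine le_of_sq_le_sq ?_ (mul_nonneg (frobNorm_nonneg _) (frobNorm_nonneg _))
  rw [mul_pow, frobNorm_sq, frobNorm_sq]
  simp only [frobInner, ← Fintype.sum_prod_type']
  simpa only [sq] using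
    Finset.sum_mul_sq_le_sq_mul_sq Finset.univ (fun p : m × n => A p.1 p.2) fun p => B p.1 p.2

theorem frobNorm_neg (A : Matrix m n ℝ) : frobNorm (-A) = frobNorm A := by
  simp [frobNorm]

theorem neg_frobInner_le (A B : Matrix m n ℝ) : -(frobNorm A * frobNorm B) ≤ frobInner A B := by
  have h := frobInner_le (-A) B
  rw [frobNorm_neg, frobInner_neg_left] at h
  linarith

theorem frobNorm_smul (c : ℝ) (A : Matrix m n ℝ) : frobNorm (c • A) = |c| * frobNorm A := by
  rw [← Real.sqrt_sq (frobNorm_nonneg (c • A)), frobNorm_sq, frobInner_smul_left,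
    frobInner_smul_right, ← frobNorm_sq, ← mul_assoc, Real.sqrt_mul (mul_self_nonneg c),
    Real.sqrt_mul_self_eq_abs, Real.sqrt_sq (frobNorm_nonneg A)]

theorem frobNorm_add_le (A B : Matrix m n ℝ) : frobNorm (A + B) ≤ frobNorm A + frobNorm B := by
  refine le_of_sq_le_sq ?_ (add_nonneg (frobNorm_nonneg _) (frobNorm_nonneg _))
  rw [frobNorm_sq, frobInner_add_left, frobInner_add_right, frobInner_add_right, add_sq,
    frobNorm_sq, frobNorm_sq, frobInner_comm B A]
  linarith [frobInner_le A B]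

theorem frobNorm_sub_le (A B : Matrix m n ℝ) : frobNorm (A - B) ≤ frobNorm A + frobNorm B := by
  rw [sub_eq_add_neg, ← frobNorm_neg B]
  exact frobNorm_add_le _ _

theorem abs_apply_le_frobNorm (A : Matrix m n ℝ) (i : m) (j : n) : |A i j| ≤ frobNorm A := by
  refine Real.abs_le_sqrt ?_
  calc A i j ^ 2 ≤ ∑ j, A i j ^ 2 :=
        Finset.single_le_sum (fun j _ => sq_nonneg (A i j)) (Finset.mem_univ j)
    _ ≤ ∑ i, ∑ j, A i j ^ 2 :=
        Finset.single_le_sum (f := fun i => ∑ j, A i j ^ 2)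
          (fun i _ => Finset.sum_nonneg fun j _ => sq_nonneg (A i j)) (Finset.mem_univ i)

theorem tendsto_frobInner {α : Type*} {l : Filter α} {A B : α → Matrix m n ℝ}
    {A₀ B₀ : Matrix m n ℝ} (hA : Tendsto A l (𝓝 A₀)) (hB : Tendsto B l (𝓝 B₀)) :
    Tendsto (fun k => frobInner (A k) (B k)) l (𝓝 (frobInner A₀ B₀)) :=
  tendsto_finsetSum _ fun i _ => tendsto_finsetSum _ fun j _ =>
    ((tendsto_pi_nhds.1 (tendsto_pi_nhds.1 hA i)) j).mul
      ((tendsto_pi_nhds.1 (tendsto_pi_nhds.1 hB i)) j)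

theorem tendsto_zero_of_frobNorm {α : Type*} {l : Filter α} {A : α → Matrix m n ℝ}
    (h : Tendsto (fun k => frobNorm (A k)) l (𝓝 0)) : Tendsto A l (𝓝 0) :=
  tendsto_pi_nhds.2 fun i => tendsto_pi_nhds.2 fun j =>
    squeeze_zero_norm (fun k => abs_apply_le_frobNorm (A k) i j) h

theorem frobInner_mul_left (A : Matrix m r ℝ) (B : Matrix r n ℝ) (C : Matrix m n ℝ) :
    frobInner (A * B) C = frobInner B (Aᵀ * C) := by
  rw [frobInner_eq_trace, frobInner_eq_trace, Matrix.transpose_mul, Matrix.mul_assoc]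

theorem frobInner_mul_right (A : Matrix m r ℝ) (B : Matrix r n ℝ) (C : Matrix m n ℝ) :
    frobInner (A * B) C = frobInner A (C * Bᵀ) := by
  rw [frobInner_eq_trace, frobInner_eq_trace, Matrix.transpose_mul, Matrix.mul_assoc,
    Matrix.trace_mul_comm, Matrix.mul_assoc]

end Frobenius

/-! ### Duality for the trace norm -/

section TraceNorm

variable {m n r : Type*} [Fintype m] [Fintype n] [Fintype r]

/-- The matrix `K` has spectral norm at most one. -/
def IsContraction (K : Matrix m n ℝ) : Prop :=
  ∀ x : n → ℝ, (K *ᵥ x) ⬝ᵥ (K *ᵥ x) ≤ x ⬝ᵥ x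

theorem dotProduct_mulVec_self (A : Matrix m n ℝ) (x : n → ℝ) :
    (A *ᵥ x) ⬝ᵥ (A *ᵥ x) = x ⬝ᵥ ((Aᵀ * A) *ᵥ x) := by
  rw [← Matrix.mulVec_mulVec, Matrix.dotProduct_mulVec x, Matrix.vecMul_transpose]

theorem dotProduct_le_sqrt (x y : m → ℝ) : x ⬝ᵥ y ≤ √(x ⬝ᵥ x) * √(y ⬝ᵥ y) := by
  simpa only [dotProduct, sq] using Real.sum_mul_le_sqrt_mul_sqrt Finset.univ x y

theorem dotProduct_self_nonneg (x : m → ℝ) : 0 ≤ x ⬝ᵥ x :=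
  Finset.sum_nonneg fun _ _ => mul_self_nonneg _

/-- A right singular basis: the columns of `V` are orthonormal eigenvectors of `Mᵀ M`. -/
theorem exists_rightSingularBasis [DecidableEq n] (M : Matrix m n ℝ) :
    ∃ (V : Matrix n (Fin (Fintype.card n)) ℝ) (s : Fin (Fintype.card n) → ℝ),
      Vᵀ * V = 1 ∧ V * Vᵀ = 1 ∧ (∀ i, 0 ≤ s i) ∧
      (M * V)ᵀ * (M * V) = Matrix.diagonal (fun i => s i ^ 2) ∧ ∑ i, s i = traceNorm M := by
  classical
  set T := Matrix.toEuclideanLin M with hT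
  have hN : Module.finrank ℝ (EuclideanSpace ℝ n) = Fintype.card n := by simp
  have hsym := T.isSymmetric_adjoint_comp_self
  set b := hsym.eigenvectorBasis hN with hb
  have hinner : ∀ x y : EuclideanSpace ℝ n, inner ℝ x y = ∑ k, x k * y k := by
    intro x y
    simp [PiLp.inner_apply, mul_comm]
  have horth : ∀ i j, ∑ k, b i k * b j k = (1 : Matrix _ _ ℝ) i j := by
    intro i j
    rw [← hinner, orthonormal_iff_ite.1 b.orthonormal, Matrix.one_apply]
  have hV : (Matrix.of fun k i => b i k)ᵀ * (Matrix.of fun k i => b i k) = 1 := by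
    ext i j
    simp only [Matrix.mul_apply, Matrix.transpose_apply, Matrix.of_apply]
    exact horth i j
  refine ⟨Matrix.of fun k i => b i k, fun i => T.singularValues i, hV, ?_,
    fun i => T.singularValues_nonneg i, ?_, ?_⟩
  · exact (Matrix.mul_eq_one_comm_of_card_eq _ _ _ (by simp)).1 hV
  · ext i j
    have hMV : ∀ k i, (M * Matrix.of fun k i => b i k) k i = T (b i) k := by
      intro k i
      simp [hT, Matrix.mul_apply, Matrix.mulVec, dotProduct]
    have h1 : inner ℝ (T (b i)) (T (b j))
        = T.singularValues j ^ 2 * (1 : Matrix _ _ ℝ) i j := by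
      rw [← LinearMap.adjoint_inner_right, ← LinearMap.comp_apply, hsym.apply_eigenvectorBasis hN j,
        T.sq_singularValues_fin hN]
      simp only [RCLike.ofReal_real_eq_id, id_eq]
      rw [real_inner_smul_right, hinner, horth]
    rw [Matrix.mul_apply]
    simp only [Matrix.transpose_apply, hMV]
    have h2 : inner ℝ (T (b i)) (T (b j)) = ∑ k, T (b i) k * T (b j) k := by
      simp [PiLp.inner_apply, mul_comm]
    rw [← h2, h1, Matrix.diagonal_apply, Matrix.one_apply]
    split_ifs with h
    · simp [h]
    · simp
  · rw [traceNorm, Finsupp.sum_of_support_subset (s := Finset.range (Fintype.card n)),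
      Finset.sum_range]
    · intro i hi
      by_contra hc
      rw [Finset.mem_range, not_lt, ← hN] at hc
      exact (Finsupp.mem_support_iff.1 hi) (T.singularValues_of_finrank_le hc)
    · simp

theorem IsContraction.frobInner_le_traceNorm [DecidableEq n] {K : Matrix m n ℝ}
    (hK : IsContraction K) (M : Matrix m n ℝ) : frobInner K M ≤ traceNorm M := by
  obtain ⟨V, s, hV, hV', hs, hM, hsum⟩ := exists_rightSingularBasis M
  have h1 : frobInner K M = frobInner (K * V) (M * V) := by
    rw [frobInner_mul_right, Matrix.mul_assoc, hV', Matrix.mul_one]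
  rw [h1, ← hsum, frobInner_eq_trace, Matrix.trace]
  refine Finset.sum_le_sum fun i _ => ?_
  have hcol : ∀ A : Matrix m n ℝ, (fun k => (A * V) k i) = A *ᵥ (fun k => V k i) := fun A => rfl
  have e1 : ((K * V)ᵀ * (M * V)).diag i = (fun k => (K * V) k i) ⬝ᵥ (fun k => (M * V) k i) := rfl
  have e2 : (fun k => (M * V) k i) ⬝ᵥ (fun k => (M * V) k i) = s i ^ 2 := by
    have := congrFun (congrFun hM i) i
    rwa [Matrix.diagonal_apply_eq] at this
  have e3 : (fun k => V k i) ⬝ᵥ (fun k => V k i) = 1 := by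
    have := congrFun (congrFun hV i) i
    rwa [Matrix.one_apply_eq] at this
  have e4 : (fun k => (K * V) k i) ⬝ᵥ (fun k => (K * V) k i) ≤ 1 := by
    rw [hcol K, ← e3]
    exact hK _
  rw [e1]
  refine (dotProduct_le_sqrt _ _).trans ?_
  rw [e2, Real.sqrt_sq (hs i)]
  exact mul_le_of_le_one_left (hs i) (Real.sqrt_le_one.2 e4)

/-- The supremum in the dual description of the trace norm is attained. -/
theorem exists_contraction_frobInner_eq [DecidableEq n] (M : Matrix m n ℝ) :
    ∃ K : Matrix m n ℝ, IsContraction K ∧ frobInner K M = traceNorm M := by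
  obtain ⟨V, s, hV, hV', hs, hM, hsum⟩ := exists_rightSingularBasis M
  refine ⟨(M * V) * (Matrix.diagonal (fun i => (s i)⁻¹) * Vᵀ), fun x => ?_, ?_⟩
  · rw [← Matrix.mulVec_mulVec, dotProduct_mulVec_self (M * V), hM, ← Matrix.mulVec_mulVec]
    have hx : x ⬝ᵥ x = (Vᵀ *ᵥ x) ⬝ᵥ (Vᵀ *ᵥ x) := by
      rw [dotProduct_mulVec_self, Matrix.transpose_transpose, hV', Matrix.one_mulVec]
    rw [hx]
    refine Finset.sum_le_sum fun i _ => ?_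
    simp only [Matrix.mulVec_diagonal]
    by_cases h : s i = 0
    · simp only [h, inv_zero, zero_mul]
      exact mul_self_nonneg _
    · refine le_of_eq ?_
      field_simp
  · rw [← hsum, frobInner_mul_left, Matrix.transpose_mul, ← frobInner_comm, Matrix.mul_assoc,
      frobInner_comm, frobInner_mul_right, Matrix.transpose_transpose, Matrix.mul_assoc,
      Matrix.mul_assoc, ← Matrix.mul_assoc, ← Matrix.transpose_mul, hM, frobInner_eq_trace,
      Matrix.diagonal_transpose, Matrix.diagonal_mul_diagonal, Matrix.trace_diagonal]
    refine Finset.sum_congr rfl fun i _ => ?_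
    by_cases h : s i = 0
    · simp [h]
    · field_simp

theorem IsContraction.transpose_mulVec_le {R : Matrix n r ℝ} [DecidableEq r] [DecidableEq n]
    (hR : Rᵀ * R = 1) : IsContraction Rᵀ := by
  intro x
  have h : 0 ≤ (x - R *ᵥ (Rᵀ *ᵥ x)) ⬝ᵥ (x - R *ᵥ (Rᵀ *ᵥ x)) := dotProduct_self_nonneg _
  have e1 : (R *ᵥ (Rᵀ *ᵥ x)) ⬝ᵥ (R *ᵥ (Rᵀ *ᵥ x)) = (Rᵀ *ᵥ x) ⬝ᵥ (Rᵀ *ᵥ x) := by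
    rw [dotProduct_mulVec_self, hR, Matrix.one_mulVec]
  have e2 : x ⬝ᵥ (R *ᵥ (Rᵀ *ᵥ x)) = (Rᵀ *ᵥ x) ⬝ᵥ (Rᵀ *ᵥ x) := by
    rw [Matrix.dotProduct_mulVec, ← Matrix.mulVec_transpose]
  rw [sub_dotProduct, dotProduct_sub, dotProduct_sub, e1, dotProduct_comm (R *ᵥ _) x, e2] at h
  linarith

theorem IsContraction.of_svd [DecidableEq r] [DecidableEq n] {P : Matrix m r ℝ} {R : Matrix n r ℝ}
    (hP : Pᵀ * P = 1) (hR : Rᵀ * R = 1) {κ : r → ℝ} (h0 : ∀ i, 0 ≤ κ i) (h1 : ∀ i, κ i ≤ 1) :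
    IsContraction (P * Matrix.diagonal κ * Rᵀ) := by
  intro x
  rw [Matrix.mul_assoc, ← Matrix.mulVec_mulVec, dotProduct_mulVec_self P, hP, Matrix.one_mulVec,
    ← Matrix.mulVec_mulVec]
  refine le_trans (Finset.sum_le_sum fun i _ => ?_) (IsContraction.transpose_mulVec_le hR x)
  simp only [Matrix.mulVec_diagonal]
  nlinarith [mul_self_nonneg ((Rᵀ *ᵥ x) i), mul_le_one₀ (h1 i) (h0 i) (h1 i)]

theorem frobInner_svd [DecidableEq r] {P : Matrix m r ℝ} {R : Matrix n r ℝ}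
    (σ : r → ℝ) (K : Matrix m n ℝ) :
    frobInner K (P * Matrix.diagonal σ * Rᵀ) = ∑ i, (Pᵀ * (K * R)) i i * σ i := by
  rw [frobInner_comm, frobInner_mul_right, frobInner_mul_left, Matrix.transpose_transpose]
  simp [frobInner, Matrix.diagonal_apply, mul_comm]

theorem IsContraction.bilinear_le_one {r : Type*} [DecidableEq r] {K : Matrix m n ℝ} (hK : IsContraction K)
    {P : Matrix m r ℝ} {R : Matrix n r ℝ} (hP : Pᵀ * P = 1) (hR : Rᵀ * R = 1) (i : r) :
    (Pᵀ * (K * R)) i i ≤ 1 := by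
  have e1 : (fun k => P k i) ⬝ᵥ (fun k => P k i) = 1 := by
    have := congrFun (congrFun hP i) i
    rwa [Matrix.one_apply_eq] at this
  have e2 : (fun k => R k i) ⬝ᵥ (fun k => R k i) = 1 := by
    have := congrFun (congrFun hR i) i
    rwa [Matrix.one_apply_eq] at this
  have e3 : (Pᵀ * (K * R)) i i = (fun k => P k i) ⬝ᵥ (K *ᵥ fun k => R k i) := rfl
  rw [e3]
  refine (dotProduct_le_sqrt _ _).trans ?_
  rw [e1, Real.sqrt_one, one_mul, Real.sqrt_le_one, ← e2]
  exact hK _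

/-- Singular value thresholding is the proximal map of the trace norm: the removed part `M - Z` is
`t` times a subgradient `K` of the trace norm at `Z`, given here by the two properties that
characterize subgradients. -/
theorem IsSVT.exists_contraction [DecidableEq m] [DecidableEq n] {t : ℝ} (ht : 0 < t)
    {M Z : Matrix m n ℝ} (h : IsSVT t M Z) :
    ∃ K : Matrix m n ℝ, IsContraction K ∧ traceNorm Z ≤ frobInner K Z ∧ M - Z = t • K := by
  obtain ⟨r, P, σ, R, hP, hR, hσ, rfl, rfl⟩ := h
  refine ⟨P * Matrix.diagonal (fun i => min (σ i / t) 1) * Rᵀ,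
    IsContraction.of_svd hP hR (fun i => le_min (div_nonneg (hσ i) ht.le) zero_le_one)
      fun i => min_le_right _ _, ?_, ?_⟩
  · obtain ⟨K, hK, hKe⟩ := exists_contraction_frobInner_eq
      (P * Matrix.diagonal (fun i => max (σ i - t) 0) * Rᵀ)
    rw [← hKe, frobInner_svd, frobInner_svd]
    refine Finset.sum_le_sum fun i _ => ?_
    have e : Pᵀ * (P * Matrix.diagonal (fun i => min (σ i / t) 1) * Rᵀ * R)
        = Matrix.diagonal (fun i => min (σ i / t) 1) := by
      rw [Matrix.mul_assoc (P * _), hR, Matrix.mul_one, ← Matrix.mul_assoc, hP, Matrix.one_mul]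
    rw [e, Matrix.diagonal_apply_eq]
    rcases le_total (σ i) t with hi | hi
    · rw [max_eq_right (by linarith), mul_zero, mul_zero]
    · rw [min_eq_right ((one_le_div ht).2 hi)]
      exact mul_le_mul_of_nonneg_right (hK.bilinear_le_one hP hR i) (le_max_right _ _)
  · rw [← Matrix.sub_mul, ← Matrix.mul_sub, Matrix.diagonal_sub, ← Matrix.smul_mul,
      ← Matrix.mul_smul, ← Matrix.diagonal_smul]
    congr 3
    funext i
    simp only [Pi.smul_apply, smul_eq_mul]
    rcases le_total (σ i) t with hi | hi
    · rw [max_eq_right (by linarith), min_eq_left ((div_le_one ht).2 hi)]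
      field_simp
      ring
    · rw [max_eq_left (by linarith), min_eq_right ((one_le_div ht).2 hi)]
      ring

theorem isSubgradient_of_contraction [DecidableEq n] {c : ℝ} (hc : 0 < c) {K Z : Matrix m n ℝ}
    (hK : IsContraction K) (hKZ : traceNorm Z ≤ frobInner K Z) :
    IsSubgradient (fun Z => traceNorm Z / c) Z (c⁻¹ • K) := by
  intro Z'
  have h := hK.frobInner_le_traceNorm Z'
  rw [frobInner_smul_left, frobInner_sub_right, inv_mul_eq_div]
  beta_reduce
  rw [← add_div]
  exact div_le_div_of_nonneg_right (by linarith) hc.le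

theorem exists_isSubgradient [DecidableEq n] {c : ℝ} (hc : 0 < c) (Z : Matrix m n ℝ) :
    ∃ Y, IsSubgradient (fun Z => traceNorm Z / c) Z Y := by
  obtain ⟨K, hK, hKZ⟩ := exists_contraction_frobInner_eq Z
  exact ⟨_, isSubgradient_of_contraction hc hK hKZ.ge⟩

theorem IsContraction.frobNorm_le [DecidableEq n] {K : Matrix m n ℝ} (hK : IsContraction K) :
    frobNorm K ≤ √(Fintype.card n) := by
  refine Real.sqrt_le_sqrt ?_
  rw [Finset.sum_comm]
  have h : ∀ j, ∑ i, K i j ^ 2 ≤ 1 := by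
    intro j
    have := hK (Pi.single j 1)
    simpa [dotProduct, sq, Matrix.mulVec_single_one, Pi.single_apply] using this
  exact (Finset.sum_le_sum fun j _ => h j).trans (by simp)

theorem traceNorm_nonneg [DecidableEq n] (M : Matrix m n ℝ) : 0 ≤ traceNorm M :=
  Finset.sum_nonneg fun i _ => LinearMap.singularValues_nonneg _ i

/-- The graph of the subdifferential is closed; only the existence of a subgradient at the limit
point is used, not the continuity of `f`. -/
theorem IsSubgradient.of_tendsto {f : Matrix m n ℝ → ℝ} {α : Type*} {l : Filter α} [l.NeBot]
    {G Y : α → Matrix m n ℝ} {G₀ Y₀ : Matrix m n ℝ} (hex : ∃ K, IsSubgradient f G₀ K)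
    (h : ∀ᶠ k in l, IsSubgradient f (G k) (Y k)) (hG : Tendsto G l (𝓝 G₀))
    (hY : Tendsto Y l (𝓝 Y₀)) : IsSubgradient f G₀ Y₀ := by
  obtain ⟨K, hK⟩ := hex
  intro Z
  have h0 : Tendsto (fun k => frobInner K (G k - G₀)) l (𝓝 (frobInner K (G₀ - G₀))) :=
    tendsto_frobInner tendsto_const_nhds (hG.sub tendsto_const_nhds)
  have h0' : Tendsto (fun k => frobInner (Y k) (Z - G k)) l (𝓝 (frobInner Y₀ (Z - G₀))) :=
    tendsto_frobInner hY (tendsto_const_nhds.sub hG)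
  have h1 := (h0.const_add (f G₀)).add h0'
  have h2 : frobInner K (G₀ - G₀) = 0 := by simp [frobInner]
  rw [h2, add_zero] at h1
  refine le_of_tendsto h1 (h.mono fun k hk => ?_)
  linarith [hk Z, hK (G k)]

/-- The subdifferential is monotone. -/
theorem IsSubgradient.monotone {f : Matrix m n ℝ → ℝ} {G G' Y Y' : Matrix m n ℝ}
    (h : IsSubgradient f G Y) (h' : IsSubgradient f G' Y') :
    0 ≤ frobInner (Y' - Y) (G' - G) := by
  have h1 := h G'
  have h2 := h' G
  rw [frobInner_sub_left]
  have h3 : frobInner Y' (G - G') = - frobInner Y' (G' - G) := by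
    rw [frobInner_sub_right, frobInner_sub_right]
    ring
  linarith

end TraceNorm

/-! ### Unfoldings and multilinear products -/

section Tensors

variable {I d : Fin 3 → ℕ}

theorem unfold_add (n : Fin 3) (X Y : Tensor d) : unfold n (X + Y) = unfold n X + unfold n Y := rfl

theorem unfold_sub (n : Fin 3) (X Y : Tensor d) : unfold n (X - Y) = unfold n X - unfold n Y := rfl

theorem unfold_smul (n : Fin 3) (c : ℝ) (X : Tensor d) : unfold n (c • X) = c • unfold n X := rfl

theorem refold_add (n : Fin 3) (M N : Unf d n) : refold n (M + N) = refold n M + refold n N := rfl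

theorem refold_sub (n : Fin 3) (M N : Unf d n) : refold n (M - N) = refold n M - refold n N := rfl

theorem refold_smul (n : Fin 3) (c : ℝ) (M : Unf d n) : refold n (c • M) = c • refold n M := rfl

theorem continuous_unfold (n : Fin 3) : Continuous (unfold n : Tensor d → Unf d n) :=
  continuous_matrix fun _ _ => continuous_apply _

theorem continuous_refold (n : Fin 3) : Continuous (refold n : Unf d n → Tensor d) :=
  continuous_pi fun _ => Continuous.matrix_elem continuous_id _ _

theorem unfold_injective (n : Fin 3) : Function.Injective (unfold n : Tensor d → Unf d n) :=
  Function.LeftInverse.injective (refold_unfold n)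

theorem sum_eq_sum_splitAt {β : Type*} [AddCommMonoid β] (n : Fin 3) (f : Idx d → β) :
    ∑ i, f i = ∑ i, ∑ c, f ((Equiv.piSplitAt n fun j => Fin (d j)).symm (i, c)) := by
  rw [← Fintype.sum_prod_type', ← (Equiv.piSplitAt n fun j => Fin (d j)).symm.sum_comp f]

theorem frobInner_unfold (n : Fin 3) (X Y : Tensor d) :
    frobInner (unfold n X) (unfold n Y) = X ⬝ᵥ Y := by
  rw [dotProduct, sum_eq_sum_splitAt n]
  rfl

theorem frobNorm_unfold (n : Fin 3) (X : Tensor d) : frobNorm (unfold n X) = tensorNorm X := by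
  rw [tensorNorm, sum_eq_sum_splitAt n]
  rfl

theorem tensorNorm_sq (X : Tensor d) : tensorNorm X ^ 2 = X ⬝ᵥ X := by
  rw [← frobNorm_unfold 0, frobNorm_sq, frobInner_unfold]

theorem splitAt_symm_self (n : Fin 3) (i : Fin (d n)) (c : ColIdx d n) :
    (Equiv.piSplitAt n fun j => Fin (d j)).symm (i, c) n = i := by
  simp [Equiv.piSplitAt]

theorem splitAt_symm_ne (n : Fin 3) (i : Fin (d n)) (c : ColIdx d n) (j : {j : Fin 3 // j ≠ n}) :
    (Equiv.piSplitAt n fun j => Fin (d j)).symm (i, c) j = c j := by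
  simp [Equiv.piSplitAt, j.2]

theorem unfold_multiProd (n : Fin 3) (G : Tensor d) (U : Factors I d) :
    unfold n (multiProd G U) = U n * unfold n G * (kron n U)ᵀ := by
  ext i a
  change multiProd G U _ = _
  rw [multiProd, sum_eq_sum_splitAt n, Matrix.mul_apply, Finset.sum_comm]
  refine Finset.sum_congr rfl fun c _ => ?_
  rw [Matrix.mul_apply, Finset.sum_mul]
  refine Finset.sum_congr rfl fun k _ => ?_
  rw [Fintype.prod_eq_mul_prod_subtype_ne _ n, splitAt_symm_self, splitAt_symm_self]
  simp only [splitAt_symm_ne]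
  simp only [Matrix.transpose_apply, kron, Matrix.of_apply, unfold]
  ring

theorem unfold_multiProdT (n : Fin 3) (X : Tensor I) (U : Factors I d) :
    unfold n (multiProdT X U) = (U n)ᵀ * partialProj n X U := by
  rw [multiProdT, unfold_multiProd, partialProj, ← Matrix.mul_assoc]
  rfl

theorem kron_congr (n : Fin 3) {U V : Factors I d} (h : ∀ m, m ≠ n → U m = V m) :
    kron n U = kron n V := by
  ext a c
  simp only [kron, Matrix.of_apply]
  exact Finset.prod_congr rfl fun j _ => by rw [h j j.2]

theorem kron_transpose_mul_self (n : Fin 3) {U : Factors I d} (hU : ∀ m, (U m)ᵀ * U m = 1) :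
    (kron n U)ᵀ * kron n U = 1 := by
  ext c c'
  simp only [Matrix.mul_apply, Matrix.transpose_apply, kron, Matrix.of_apply,
    ← Finset.prod_mul_distrib]
  have h := Finset.prod_univ_sum
    (fun j : {j : Fin 3 // j ≠ n} => (Finset.univ : Finset (Fin (I j))))
    (fun j k => U j k (c j) * U j k (c' j))
  rw [Fintype.piFinset_univ] at h
  rw [← h]
  have h2 : ∀ j : {j : Fin 3 // j ≠ n}, ∑ k, U j k (c j) * U j k (c' j)
      = if c j = c' j then 1 else 0 := by
    intro j
    have := congrFun (congrFun (hU j) (c j)) (c' j)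
    rwa [Matrix.mul_apply, Matrix.one_apply] at this
  simp only [h2]
  by_cases hc : c = c'
  · subst hc
    simp
  · obtain ⟨j, hj⟩ := Function.ne_iff.1 hc
    rw [Matrix.one_apply_ne hc]
    exact Finset.prod_eq_zero (Finset.mem_univ j) (if_neg hj)

theorem multiProd_dotProduct (G : Tensor d) (X : Tensor I) (U : Factors I d) :
    multiProd G U ⬝ᵥ X = G ⬝ᵥ multiProdT X U := by
  rw [← frobInner_unfold 0, ← frobInner_unfold 0, unfold_multiProd, unfold_multiProdT, partialProj,
    frobInner_mul_right, frobInner_mul_left, Matrix.transpose_transpose]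

theorem multiProdT_multiProd (G : Tensor d) {U : Factors I d} (hU : ∀ m, (U m)ᵀ * U m = 1) :
    multiProdT (multiProd G U) U = G := by
  apply unfold_injective 0
  rw [unfold_multiProdT, partialProj, unfold_multiProd, Matrix.mul_assoc, Matrix.mul_assoc,
    kron_transpose_mul_self 0 hU, Matrix.mul_one, ← Matrix.mul_assoc, hU, Matrix.one_mul]

theorem tendsto_multiProd {α : Type*} {l : Filter α} {C : α → Tensor d} {U : α → Factors I d}
    {C₀ : Tensor d} {U₀ : Factors I d} (hC : Tendsto C l (𝓝 C₀)) (hU : Tendsto U l (𝓝 U₀)) :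
    Tendsto (fun k => multiProd (C k) (U k)) l (𝓝 (multiProd C₀ U₀)) :=
  tendsto_pi_nhds.2 fun _ => tendsto_finsetSum _ fun j _ =>
    (tendsto_pi_nhds.1 hC j).mul (tendsto_finsetProd _ fun n _ =>
      tendsto_pi_nhds.1 (tendsto_pi_nhds.1 (tendsto_pi_nhds.1 hU n) _) _)

theorem tendsto_multiProdT {α : Type*} {l : Filter α} {X : α → Tensor I} {U : α → Factors I d}
    {X₀ : Tensor I} {U₀ : Factors I d} (hX : Tendsto X l (𝓝 X₀)) (hU : Tendsto U l (𝓝 U₀)) :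
    Tendsto (fun k => multiProdT (X k) (U k)) l (𝓝 (multiProdT X₀ U₀)) :=
  tendsto_multiProd hX (tendsto_pi_nhds.2 fun n => tendsto_pi_nhds.2 fun _ =>
    tendsto_pi_nhds.2 fun _ => tendsto_pi_nhds.1 (tendsto_pi_nhds.1 (tendsto_pi_nhds.1 hU n) _) _)

theorem continuous_kron (n : Fin 3) : Continuous (kron n : Factors I d → _) :=
  continuous_matrix fun _ _ => continuous_finsetProd Finset.univ
    fun (j : {j : Fin 3 // j ≠ n}) _ => Continuous.matrix_elem (continuous_apply j.1) _ _

/-- For factors with orthonormal columns, the fit of the model is a quadratic function of the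
core tensor with identity Hessian. -/
theorem dotProduct_self_sub_multiProd (X : Tensor I) (C : Tensor d) {U : Factors I d}
    (hU : ∀ m, (U m)ᵀ * U m = 1) :
    (X - multiProd C U) ⬝ᵥ (X - multiProd C U)
      = X ⬝ᵥ X - 2 * (C ⬝ᵥ multiProdT X U) + C ⬝ᵥ C := by
  rw [sub_dotProduct, dotProduct_sub, dotProduct_sub, dotProduct_comm X (multiProd C U),
    multiProd_dotProduct, multiProd_dotProduct, multiProdT_multiProd C hU]
  ring

end Tensors

/-! ### The cost of the factors -/

section FactorCost

variable {I d : Fin 3 → ℕ} (P : Problem I)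

theorem Problem.h_eq (U : Factors I d) : P.h U = ∑ n, frobInner (U n) (P.lap n * U n) := by
  simp only [Problem.h, frobInner_eq_trace, Matrix.mul_assoc]

theorem Problem.h_update (U : Factors I d) (n : Fin 3) (A : Matrix (Fin (I n)) (Fin (d n)) ℝ) :
    P.h (Function.update U n A) = frobInner A (P.lap n * A)
      + ∑ m ∈ Finset.univ.erase n, frobInner (U m) (P.lap m * U m) := by
  rw [Problem.h_eq, ← Finset.add_sum_erase _ _ (Finset.mem_univ n), Function.update_self]
  congr 1
  refine Finset.sum_congr rfl fun m hm => ?_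
  rw [Function.update_of_ne (Finset.ne_of_mem_erase hm)]

/-- The explicit gradient of `factorCost` in the factor of mode `n`. -/
noncomputable def explicitGrad (ρ : ℝ) (X : Tensor I) (B : Tensor d) (U : Factors I d) (n : Fin 3)
    (A : Matrix (Fin (I n)) (Fin (d n)) ℝ) : Matrix (Fin (I n)) (Fin (d n)) ℝ :=
  -((1 + 3 * ρ)⁻¹ • (partialProj n X U * (Aᵀ * partialProj n X U + ρ • unfold n B)ᵀ))
    + (P.mu / 2) • ((P.lap n + (P.lap n)ᵀ) * A)

/-- The quadratic part of `factorCost` in the factor of mode `n`, that is, half of the quadratic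
form of its (constant) Hessian. -/
noncomputable def quadPart (ρ : ℝ) (X : Tensor I) (U : Factors I d) (n : Fin 3)
    (H : Matrix (Fin (I n)) (Fin (d n)) ℝ) : ℝ :=
  -(frobInner (Hᵀ * partialProj n X U) (Hᵀ * partialProj n X U)) / (2 * (1 + 3 * ρ))
    + P.mu / 2 * frobInner H (P.lap n * H)

theorem quadPart_smul (ρ : ℝ) (X : Tensor I) (U : Factors I d) (n : Fin 3) (t : ℝ)
    (H : Matrix (Fin (I n)) (Fin (d n)) ℝ) :
    quadPart P ρ X U n (t • H) = t ^ 2 * quadPart P ρ X U n H := by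
  simp only [quadPart, Matrix.transpose_smul, Matrix.smul_mul, Matrix.mul_smul,
    frobInner_smul_left, frobInner_smul_right]
  ring

theorem factorCost_update (ρ : ℝ) (X : Tensor I) (B : Tensor d) (U : Factors I d) (n : Fin 3)
    (A : Matrix (Fin (I n)) (Fin (d n)) ℝ) :
    factorCost P ρ X B (Function.update U n A) =
      -(frobInner (Aᵀ * partialProj n X U + ρ • unfold n B)
          (Aᵀ * partialProj n X U + ρ • unfold n B)) / (2 * (1 + 3 * ρ))
        + P.mu / 2 * (frobInner A (P.lap n * A)
          + ∑ m ∈ Finset.univ.erase n, frobInner (U m) (P.lap m * U m)) := by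
  have h : unfold n (multiProdT X (Function.update U n A) + ρ • B)
      = Aᵀ * partialProj n X U + ρ • unfold n B := by
    rw [unfold_add, unfold_smul, unfold_multiProdT, Function.update_self, partialProj, partialProj,
      kron_congr n fun m hm => Function.update_of_ne hm A U]
  rw [factorCost, Problem.h_update, ← frobNorm_unfold n, h, frobNorm_sq]

theorem factorCost_update_add {ρ : ℝ} (hρ : 0 < ρ) (X : Tensor I) (B : Tensor d) (U : Factors I d)
    (n : Fin 3) (A H : Matrix (Fin (I n)) (Fin (d n)) ℝ) :
    factorCost P ρ X B (Function.update U n (A + H)) = factorCost P ρ X B (Function.update U n A)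
      + frobInner (explicitGrad P ρ X B U n A) H + quadPart P ρ X U n H := by
  rw [factorCost_update, factorCost_update, quadPart, explicitGrad]
  set M := partialProj n X U
  set N := Aᵀ * M + ρ • unfold n B
  have e1 : (A + H)ᵀ * M + ρ • unfold n B = N + Hᵀ * M := by
    rw [Matrix.transpose_add, Matrix.add_mul, add_right_comm]
  have e2 : frobInner (M * Nᵀ) H = frobInner N (Hᵀ * M) := by
    rw [frobInner_mul_right, Matrix.transpose_transpose, frobInner_comm N, frobInner_mul_left,
      Matrix.transpose_transpose]
  have e3 : frobInner ((P.lap n + (P.lap n)ᵀ) * A) H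
      = frobInner A (P.lap n * H) + frobInner H (P.lap n * A) := by
    rw [Matrix.add_mul, frobInner_add_left, add_comm, frobInner_mul_left, frobInner_comm _ H,
      Matrix.transpose_transpose]
  have hne : 1 + 3 * ρ ≠ 0 := by positivity
  rw [e1, frobInner_add_left _ _ H, frobInner_neg_left, frobInner_smul_left,
    frobInner_smul_left, e2, e3, Matrix.mul_add]
  simp only [frobInner_add_left, frobInner_add_right, frobInner_comm (Hᵀ * M) N]
  field_simp
  ring

theorem factorGrad_eq {ρ : ℝ} (hρ : 0 < ρ) (X : Tensor I) (B : Tensor d) (U : Factors I d)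
    (n : Fin 3) (A : Matrix (Fin (I n)) (Fin (d n)) ℝ) :
    factorGrad P ρ X B U n A = explicitGrad P ρ X B U n A := by
  ext i j
  simp only [factorGrad, Matrix.of_apply]
  have h : frobInner (explicitGrad P ρ X B U n A) (Matrix.single i j 1)
      = explicitGrad P ρ X B U n A i j := by
    simp [frobInner, Matrix.single_apply, ite_and]
  simp only [factorCost_update_add P hρ, quadPart_smul, frobInner_smul_right, h]
  set g := explicitGrad P ρ X B U n A i j
  set q := quadPart P ρ X U n (Matrix.single i j 1)
  have h1 : HasDerivAt (fun t : ℝ => factorCost P ρ X B (Function.update U n A) + t * g + t ^ 2 * q)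
      (1 * g + (2 : ℕ) * (0 : ℝ) ^ (2 - 1) * q) 0 :=
    (((hasDerivAt_id (0 : ℝ)).mul_const g).const_add _).add ((hasDerivAt_pow 2 (0 : ℝ)).mul_const q)
  rw [h1.deriv]
  simp

theorem ortArg_eq (z z' : Iterate I d) (hρ : 0 < z.rho) (n : Fin 3) (τ : ℝ) :
    ortArg P z z' n τ = (1 + 3 * z.rho) • (τ • z.U n - explicitGrad P z.rho z.X
      (calB z.rho z'.G z.Y) (currentFactors n z.U z'.U) n (z.U n)) := by
  have hne : 1 + 3 * z.rho ≠ 0 := by positivity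
  simp only [ortArg, explicitGrad]
  set M := partialProj n z.X (currentFactors n z.U z'.U)
  set B := unfold n (calB z.rho z'.G z.Y)
  set A := z.U n
  simp only [Matrix.transpose_sub, Matrix.transpose_mul, Matrix.transpose_smul,
    Matrix.transpose_transpose, Matrix.transpose_add, Matrix.sub_mul, Matrix.add_mul,
    Matrix.mul_add, Matrix.smul_mul, Matrix.mul_smul, smul_sub, smul_add, smul_neg, smul_smul,
    Matrix.mul_assoc]
  match_scalars <;> field_simp
  norm_num

/-- If the gradient of a quadratic function is Lipschitz with constant `t`, then the function lies
below its linearization plus `t/2` times the squared distance. -/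
theorem quadPart_le {z z' : Iterate I d} (hρ : 0 < z.rho) {n : Fin 3} {t : ℝ}
    (ht : GradLipschitz P z z' n t) (H : Matrix (Fin (I n)) (Fin (d n)) ℝ) :
    quadPart P z.rho z.X (currentFactors n z.U z'.U) n H ≤ t / 2 * frobInner H H := by
  have h := ht H 0
  simp only [factorGrad_eq P hρ] at h
  set B := calB z.rho z'.G z.Y
  set U := currentFactors n z.U z'.U
  have h1 := factorCost_update_add P hρ z.X B U n 0 H
  have h2 := factorCost_update_add P hρ z.X B U n H ((-1 : ℝ) • H)
  rw [quadPart_smul, neg_one_smul, add_neg_cancel, ← neg_one_smul ℝ, frobInner_smul_right] at h2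
  rw [zero_add] at h1
  have h3 := frobInner_le (explicitGrad P z.rho z.X B U n H - explicitGrad P z.rho z.X B U n 0) H
  have h4 := mul_le_mul_of_nonneg_right h (frobNorm_nonneg H)
  rw [sub_zero, mul_assoc, ← sq, frobNorm_sq] at h4
  rw [frobInner_sub_left] at h3
  linarith

end FactorCost

/-! ### Orthonormalization -/

section Orthonormalization

variable {m n : Type*} [Fintype m] [Fintype n] [DecidableEq n] {A Q : Matrix m n ℝ}

theorem IsORT.transpose_mul_self (h : IsORT A Q) : Qᵀ * Q = 1 := by
  obtain ⟨P, σ, R, hP, hR, hσ, rfl, rfl⟩ := h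
  rw [Matrix.transpose_mul, Matrix.transpose_transpose, Matrix.mul_assoc, ← Matrix.mul_assoc Pᵀ, hP,
    Matrix.one_mul, mul_eq_one_comm.1 hR]

/-- The orthonormalization of `A` maximizes the linear functional `⟨A, ·⟩` over the matrices with
orthonormal columns. -/
theorem IsORT.frobInner_le (h : IsORT A Q) {Z : Matrix m n ℝ} (hZ : Zᵀ * Z = 1) :
    frobInner A Z ≤ frobInner A Q := by
  obtain ⟨P, σ, R, hP, hR, hσ, rfl, rfl⟩ := h
  have hZc : IsContraction Z := fun x => by
    rw [dotProduct_mulVec_self, hZ, Matrix.one_mulVec]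
  rw [frobInner_comm, frobInner_svd, frobInner_comm, frobInner_svd]
  refine Finset.sum_le_sum fun i _ => mul_le_mul_of_nonneg_right ?_ (hσ i)
  rw [Matrix.mul_assoc P, hR, Matrix.mul_one, hP, Matrix.one_apply_eq]
  exact hZc.bilinear_le_one hP hR i

/-- The orthonormalization is the orthogonal factor of a polar decomposition. -/
theorem IsORT.polar (h : IsORT A Q) : A = Q * (Qᵀ * A) ∧ (Qᵀ * A)ᵀ = Qᵀ * A := by
  obtain ⟨P, σ, R, hP, hR, hσ, rfl, rfl⟩ := h
  have h1 : (P * Rᵀ)ᵀ * (P * Matrix.diagonal σ * Rᵀ) = R * (Matrix.diagonal σ * Rᵀ) := by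
    rw [Matrix.transpose_mul, Matrix.transpose_transpose, Matrix.mul_assoc, Matrix.mul_assoc P,
      ← Matrix.mul_assoc Pᵀ, hP, Matrix.one_mul]
  rw [h1]
  constructor
  · rw [Matrix.mul_assoc P Rᵀ, ← Matrix.mul_assoc Rᵀ, hR, Matrix.one_mul, Matrix.mul_assoc]
  · simp [Matrix.transpose_mul, Matrix.mul_assoc]

theorem frobInner_self_of_orthonormal (hQ : Qᵀ * Q = 1) : frobInner Q Q = Fintype.card n := by
  rw [frobInner_eq_trace, hQ, Matrix.trace_one]

theorem neg_le_frobInner_mul_of_orthonormal [DecidableEq m] (L : Matrix m m ℝ) (hQ : Qᵀ * Q = 1) :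
    -(frobNorm L * √(Fintype.card n)) ≤ frobInner Q (L * Q) := by
  have h : frobNorm (Q * Qᵀ) = √(Fintype.card n) := by
    rw [← Real.sqrt_sq (frobNorm_nonneg (Q * Qᵀ)), frobNorm_sq, frobInner_mul_left,
      ← Matrix.mul_assoc, hQ, Matrix.one_mul, frobInner_eq_trace, Matrix.transpose_transpose,
      Matrix.trace_mul_comm, hQ, Matrix.trace_one]
  rw [frobInner_comm, frobInner_mul_right, ← h]
  exact neg_frobInner_le _ _

end Orthonormalization

/-! ### One iteration -/

section Step

variable {I d : Fin 3 → ℕ} {P : Problem I} {z z' : Iterate I d} {τ : Fin 3 → ℝ}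

theorem currentFactors_self (n : Fin 3) (U U' : Factors I d) : currentFactors n U U' n = U n := by
  simp [currentFactors]

/-- Decrease of the cost in the update of one factor: the orthonormalization minimizes a quadratic
majorant, which leaves the gap between the curvature `τ` of the majorant and a smaller Lipschitz
constant `τ - ε` of the gradient. -/
theorem IsStep.factorCost_update_le (h : IsStep P z z' τ) (hρ : 0 < z.rho) {n : Fin 3}
    (hU : (z.U n)ᵀ * z.U n = 1) {ε : ℝ} (ht : GradLipschitz P z z' n (τ n - ε)) :
    factorCost P z.rho z.X (calB z.rho z'.G z.Y)
        (Function.update (currentFactors n z.U z'.U) n (z'.U n))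
      ≤ factorCost P z.rho z.X (calB z.rho z'.G z.Y) (currentFactors n z.U z'.U)
        - ε / 2 * frobNorm (z'.U n - z.U n) ^ 2 := by
  have hort := h.U_update n
  have hU' := hort.transpose_mul_self
  have h1 := factorCost_update_add P hρ z.X (calB z.rho z'.G z.Y) (currentFactors n z.U z'.U) n
    (z.U n) (z'.U n - z.U n)
  rw [add_sub_cancel] at h1
  rw [(Function.update_eq_self_iff (f := currentFactors n z.U z'.U)).2
    (currentFactors_self n z.U z'.U).symm] at h1
  have h2 := quadPart_le P hρ ht (z'.U n - z.U n)
  have h3 := hort.frobInner_le hU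
  rw [ortArg_eq P z z' hρ, frobInner_smul_left, frobInner_smul_left] at h3
  have h4 := le_of_mul_le_mul_left h3 (by positivity)
  rw [h1, frobNorm_sq]
  simp only [frobInner_sub_left, frobInner_sub_right, frobInner_smul_left,
    frobInner_comm (z'.U n) (z.U n)] at h2 h4 ⊢
  rw [frobInner_self_of_orthonormal hU, frobInner_self_of_orthonormal hU'] at *
  linarith

theorem IsStep.factorCost_le (h : IsStep P z z' τ) (hρ : 0 < z.rho)
    (hU : ∀ n, (z.U n)ᵀ * z.U n = 1) {ε : ℝ} (ht : ∀ n, GradLipschitz P z z' n (τ n - ε)) :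
    factorCost P z.rho z.X (calB z.rho z'.G z.Y) z'.U
      ≤ factorCost P z.rho z.X (calB z.rho z'.G z.Y) z.U
        - ε / 2 * ∑ n, frobNorm (z'.U n - z.U n) ^ 2 := by
  have e0 : currentFactors 0 z.U z'.U = z.U := by
    funext m
    simp [currentFactors]
  have e1 : Function.update (currentFactors 0 z.U z'.U) 0 (z'.U 0) = currentFactors 1 z.U z'.U := by
    funext m
    fin_cases m <;> simp [currentFactors, Function.update]
  have e2 : Function.update (currentFactors 1 z.U z'.U) 1 (z'.U 1) = currentFactors 2 z.U z'.U := by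
    funext m
    fin_cases m <;> simp [currentFactors, Function.update]
  have e3 : Function.update (currentFactors 2 z.U z'.U) 2 (z'.U 2) = z'.U := by
    funext m
    fin_cases m <;> simp [currentFactors, Function.update]
  have h0 := h.factorCost_update_le hρ (hU 0) (ht 0)
  have h1 := h.factorCost_update_le hρ (hU 1) (ht 1)
  have h2 := h.factorCost_update_le hρ (hU 2) (ht 2)
  rw [e1, e0] at h0
  rw [e2] at h1
  rw [e3] at h2
  rw [Fin.sum_univ_three]
  linarith

/-- The augmented Lagrangian of the model split by `Gₙ = 𝒢₍ₙ₎`. -/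
noncomputable def augLagrangian (P : Problem I) (ρ : ℝ) (Y G : ∀ n, Unf d n) (C : Tensor d) (U : Factors I d)
    (X : Tensor I) : ℝ :=
  ∑ n, (traceNorm (G n) / (3 * P.lam) + frobInner (Y n) (unfold n C - G n)
      + ρ / 2 * frobInner (unfold n C - G n) (unfold n C - G n))
    + (X - multiProd C U) ⬝ᵥ (X - multiProd C U) / 2 + P.mu / 2 * P.h U

/-- The update of `Gₙ` is a proximal step, so that the shifted multiplier is a subgradient of the
trace norm term at the new matrix. -/
theorem IsStep.exists_contraction (h : IsStep P z z' τ) (hlam : 0 < P.lam) (hρ : 0 < z.rho)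
    (n : Fin 3) : ∃ K : Unf d n, IsContraction K ∧ traceNorm (z'.G n) ≤ frobInner K (z'.G n) ∧
      z.Y n + z.rho • (unfold n z.core - z'.G n) = (3 * P.lam)⁻¹ • K := by
  obtain ⟨K, hK, hKG, he⟩ := (h.G_update n).exists_contraction (by positivity)
  refine ⟨K, hK, hKG, ?_⟩
  have e : z.Y n + z.rho • (unfold n z.core - z'.G n)
      = z.rho • (unfold n z.core + z.rho⁻¹ • z.Y n - z'.G n) := by
    match_scalars <;> field_simp
  rw [e, he, smul_smul]
  congr 1
  field_simp

theorem IsStep.isSubgradient (h : IsStep P z z' τ) (hlam : 0 < P.lam) (hρ : 0 < z.rho)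
    (n : Fin 3) : IsSubgradient (fun Z => traceNorm Z / (3 * P.lam)) (z'.G n)
      (z.Y n + z.rho • (unfold n z.core - z'.G n)) := by
  obtain ⟨K, hK, hKG, he⟩ := h.exists_contraction hlam hρ n
  rw [he]
  exact isSubgradient_of_contraction (by positivity) hK hKG

theorem IsStep.augLagrangian_G_le (h : IsStep P z z' τ) (hlam : 0 < P.lam) (hρ : 0 < z.rho)
    (U : Factors I d) (X : Tensor I) :
    augLagrangian P z.rho z.Y z'.G z.core U X ≤ augLagrangian P z.rho z.Y z.G z.core U X := by
  refine add_le_add_left (add_le_add_left (Finset.sum_le_sum fun n _ => ?_) _) _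
  have h1 := h.isSubgradient hlam hρ n (z.G n)
  beta_reduce at h1
  have h2 := mul_nonneg hρ.le (frobInner_self_nonneg (z.G n - z'.G n))
  simp only [frobInner_add_left, frobInner_sub_left, frobInner_sub_right, frobInner_smul_left,
    frobInner_comm (z.G n) (z'.G n), frobInner_comm (z.G n) (unfold n z.core),
    frobInner_comm (z'.G n) (unfold n z.core)] at *
  linarith

/-- The part of the augmented Lagrangian that does not depend on the core tensor and the
factors. -/
noncomputable def coreFreePart (P : Problem I) (ρ : ℝ) (Y G : ∀ n, Unf d n) (X : Tensor I) : ℝ :=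
  ∑ n, (traceNorm (G n) / (3 * P.lam)
      + ρ / 2 * frobInner (G n - ρ⁻¹ • Y n) (G n - ρ⁻¹ • Y n) - frobInner (Y n) (Y n) / (2 * ρ))
    + X ⬝ᵥ X / 2

/-- For orthonormal factors, minimizing the augmented Lagrangian over the core tensor leaves
`factorCost` as the function of the factors. -/
theorem augLagrangian_eq {ρ : ℝ} (hρ : 0 < ρ) (Y G : ∀ n, Unf d n) (C : Tensor d)
    {U : Factors I d} (hU : ∀ n, (U n)ᵀ * U n = 1) (X : Tensor I) :
    augLagrangian P ρ Y G C U X = coreFreePart P ρ Y G X + factorCost P ρ X (calB ρ G Y) U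
      + (1 + 3 * ρ) / 2 * tensorNorm
          (C - (1 + 3 * ρ)⁻¹ • (ρ • calB ρ G Y + multiProdT X U)) ^ 2 := by
  have hne : 1 + 3 * ρ ≠ 0 := by positivity
  have hmode : ∀ n, traceNorm (G n) / (3 * P.lam) + frobInner (Y n) (unfold n C - G n)
      + ρ / 2 * frobInner (unfold n C - G n) (unfold n C - G n)
      = (traceNorm (G n) / (3 * P.lam)
        + ρ / 2 * frobInner (G n - ρ⁻¹ • Y n) (G n - ρ⁻¹ • Y n) - frobInner (Y n) (Y n) / (2 * ρ))
        + ρ / 2 * (C ⬝ᵥ C) - ρ * (C ⬝ᵥ refold n (G n - ρ⁻¹ • Y n)) := by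
    intro n
    rw [← frobInner_unfold n C C, ← frobInner_unfold n C (refold n _), unfold_refold]
    simp only [frobInner_sub_left, frobInner_sub_right, frobInner_smul_left, frobInner_smul_right,
      frobInner_comm (G n) (unfold n C), frobInner_comm (Y n) (unfold n C),
      frobInner_comm (Y n) (G n)]
    field_simp
    ring
  have hB : C ⬝ᵥ calB ρ G Y = ∑ n, C ⬝ᵥ refold n (G n - ρ⁻¹ • Y n) := by
    rw [calB, dotProduct_sum]
  rw [augLagrangian, coreFreePart, Finset.sum_congr rfl fun n _ => hmode n,
    Finset.sum_sub_distrib, Finset.sum_add_distrib,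
    ← Finset.mul_sum Finset.univ (fun n => C ⬝ᵥ refold n (G n - ρ⁻¹ • Y n)) ρ, ← hB,
    dotProduct_self_sub_multiProd X C hU, factorCost, tensorNorm_sq, tensorNorm_sq]
  set S := ∑ n, (traceNorm (G n) / (3 * P.lam)
        + ρ / 2 * frobInner (G n - ρ⁻¹ • Y n) (G n - ρ⁻¹ • Y n) - frobInner (Y n) (Y n) / (2 * ρ))
  set B := calB ρ G Y
  set A := multiProdT X U
  simp only [dotProduct_sub, sub_dotProduct, dotProduct_add, add_dotProduct, dotProduct_smul,
    smul_dotProduct, smul_eq_mul, dotProduct_comm B C, dotProduct_comm A C, dotProduct_comm B A,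
    Finset.sum_const, Finset.card_univ, Fintype.card_fin, nsmul_eq_mul, Nat.cast_ofNat]
  field_simp
  ring

theorem IsStep.augLagrangian_core_le (h : IsStep P z z' τ) (hρ : 0 < z.rho)
    (hU : ∀ n, (z.U n)ᵀ * z.U n = 1) {ε : ℝ} (ht : ∀ n, GradLipschitz P z z' n (τ n - ε)) :
    augLagrangian P z.rho z.Y z'.G z'.core z'.U z.X
      ≤ augLagrangian P z.rho z.Y z'.G z.core z.U z.X
        - ε / 2 * ∑ n, frobNorm (z'.U n - z.U n) ^ 2 := by
  rw [augLagrangian_eq hρ _ _ _ hU, augLagrangian_eq hρ _ _ _ fun n =>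
    (h.U_update n).transpose_mul_self, ← h.core_update, sub_self, tensorNorm_sq, dotProduct_zero]
  have h1 := h.factorCost_le hρ hU ht
  have h2 : 0 ≤ (1 + 3 * z.rho) / 2 * tensorNorm (z.core - (1 + 3 * z.rho)⁻¹ •
    (z.rho • calB z.rho z'.G z.Y + multiProdT z.X z.U)) ^ 2 := by positivity
  linarith

theorem IsStep.augLagrangian_X_le (h : IsStep P z z' τ) (hX : ∀ i ∈ P.Ω, z.X i = P.T i)
    (ρ : ℝ) (Y G : ∀ n, Unf d n) :
    augLagrangian P ρ Y G z'.core z'.U z'.X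
      ≤ augLagrangian P ρ Y G z'.core z'.U z.X - tensorNorm (z'.X - z.X) ^ 2 / 2 := by
  have h1 : (z'.X - multiProd z'.core z'.U) ⬝ᵥ (z'.X - multiProd z'.core z'.U)
      + (z'.X - z.X) ⬝ᵥ (z'.X - z.X)
      ≤ (z.X - multiProd z'.core z'.U) ⬝ᵥ (z.X - multiProd z'.core z'.U) := by
    simp only [dotProduct]
    rw [← Finset.sum_add_distrib]
    refine Finset.sum_le_sum fun i _ => le_of_eq ?_
    simp only [Pi.sub_apply, h.X_update]
    split_ifs with hi
    · rw [hX i hi]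
      ring
    · ring
  rw [tensorNorm_sq]
  unfold augLagrangian
  linarith

theorem IsStep.unfold_core_sub (h : IsStep P z z' τ) (hρ : 0 < z.rho) (n : Fin 3) :
    unfold n z'.core - z'.G n = z.rho⁻¹ • (z'.Y n - z.Y n) := by
  rw [h.Y_update n, add_sub_cancel_left, smul_smul, inv_mul_cancel₀ hρ.ne', one_smul]

theorem IsStep.augLagrangian_Y_le (h : IsStep P z z' τ) {c γ : ℝ} (hc : 0 < c) (hγ : 1 < γ)
    (hρc : c ≤ z.rho) (hρ' : z'.rho ≤ γ * z.rho) :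
    augLagrangian P z'.rho z'.Y z'.G z'.core z'.U z'.X
      ≤ augLagrangian P z.rho z.Y z'.G z'.core z'.U z'.X
        + ∑ n, (1 + γ) / c * frobNorm (z'.Y n - z.Y n) ^ 2 := by
  have hρ : 0 < z.rho := hc.trans_le hρc
  have hmain : ∀ n, traceNorm (z'.G n) / (3 * P.lam)
      + frobInner (z'.Y n) (unfold n z'.core - z'.G n)
      + z'.rho / 2 * frobInner (unfold n z'.core - z'.G n) (unfold n z'.core - z'.G n)
      ≤ traceNorm (z'.G n) / (3 * P.lam) + frobInner (z.Y n) (unfold n z'.core - z'.G n)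
      + z.rho / 2 * frobInner (unfold n z'.core - z'.G n) (unfold n z'.core - z'.G n)
      + (1 + γ) / c * frobNorm (z'.Y n - z.Y n) ^ 2 := by
    intro n
    have e : z'.Y n = z.Y n + (z'.Y n - z.Y n) := (add_sub_cancel _ _).symm
    rw [h.unfold_core_sub hρ n, frobNorm_sq]
    set D := z'.Y n - z.Y n
    rw [e, frobInner_add_left]
    simp only [frobInner_smul_right, frobInner_smul_left]
    have hD := frobInner_self_nonneg D
    have h1 : z.rho⁻¹ + (z'.rho - z.rho) / 2 * (z.rho⁻¹ * z.rho⁻¹) ≤ (1 + γ) / c := by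
      have h2 : (z'.rho - z.rho) / 2 ≤ γ * z.rho := by nlinarith
      have h3 : (z'.rho - z.rho) / 2 * (z.rho⁻¹ * z.rho⁻¹) ≤ γ * z.rho * (z.rho⁻¹ * z.rho⁻¹) :=
        mul_le_mul_of_nonneg_right h2 (by positivity)
      have h4 : γ * z.rho * (z.rho⁻¹ * z.rho⁻¹) = γ * z.rho⁻¹ := by field_simp
      have h5 : z.rho⁻¹ ≤ c⁻¹ := inv_anti₀ hc hρc
      have h6 : γ * z.rho⁻¹ ≤ γ * c⁻¹ := mul_le_mul_of_nonneg_left h5 (by linarith)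
      have h7 : (1 + γ) / c = c⁻¹ + γ * c⁻¹ := by ring
      linarith
    have h7 := mul_le_mul_of_nonneg_right h1 hD
    linarith
  have hs := (Finset.sum_le_sum fun n (_ : n ∈ Finset.univ) => hmain n).trans_eq
    Finset.sum_add_distrib
  unfold augLagrangian
  linarith

/-- The augmented Lagrangian decreases along one iteration, up to a multiple of the squared change
of the multipliers. -/
theorem IsStep.augLagrangian_le (h : IsStep P z z' τ) (hlam : 0 < P.lam) {c γ : ℝ} (hc : 0 < c)
    (hγ : 1 < γ) (hρc : c ≤ z.rho) (hρ' : z'.rho ≤ γ * z.rho)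
    (hU : ∀ n, (z.U n)ᵀ * z.U n = 1) (hX : ∀ i ∈ P.Ω, z.X i = P.T i) {ε : ℝ}
    (ht : ∀ n, GradLipschitz P z z' n (τ n - ε)) :
    augLagrangian P z'.rho z'.Y z'.G z'.core z'.U z'.X
      ≤ augLagrangian P z.rho z.Y z.G z.core z.U z.X
        + ∑ n, (1 + γ) / c * frobNorm (z'.Y n - z.Y n) ^ 2
        - (ε / 2 * ∑ n, frobNorm (z'.U n - z.U n) ^ 2 + tensorNorm (z'.X - z.X) ^ 2 / 2) := by
  have hρ : 0 < z.rho := hc.trans_le hρc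
  have h1 := h.augLagrangian_G_le hlam hρ z.U z.X
  have h2 := h.augLagrangian_core_le hρ hU ht
  have h3 := h.augLagrangian_X_le hX z.rho z.Y z'.G
  have h4 := h.augLagrangian_Y_le hc hγ hρc hρ'
  linarith

/-- A lower bound of the augmented Lagrangian after an iteration with bounded multipliers. -/
theorem IsStep.le_augLagrangian (h : IsStep P z z' τ) (hlam : 0 < P.lam) (hmu : 0 ≤ P.mu) {c : ℝ}
    (hc : 0 < c) (hρc : c ≤ z.rho) (hρ' : 0 < z'.rho) {b : Fin 3 → ℝ}
    (hY : ∀ n, frobNorm (z.Y n) ≤ b n) (hY' : ∀ n, frobNorm (z'.Y n) ≤ b n) :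
    -(∑ n, b n * (c⁻¹ * (b n + b n))) - P.mu / 2 * ∑ n, frobNorm (P.lap n) * √(d n)
      ≤ augLagrangian P z'.rho z'.Y z'.G z'.core z'.U z'.X := by
  have hρ : 0 < z.rho := hc.trans_le hρc
  have h1 : ∀ n, -(b n * (c⁻¹ * (b n + b n)))
      ≤ traceNorm (z'.G n) / (3 * P.lam) + frobInner (z'.Y n) (unfold n z'.core - z'.G n)
      + z'.rho / 2 * frobInner (unfold n z'.core - z'.G n) (unfold n z'.core - z'.G n) := by
    intro n
    have hb : 0 ≤ b n := (frobNorm_nonneg _).trans (hY n)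
    have h2 : 0 ≤ traceNorm (z'.G n) / (3 * P.lam) :=
      div_nonneg (traceNorm_nonneg _) (by positivity)
    have h3 := mul_nonneg (half_pos hρ').le (frobInner_self_nonneg (unfold n z'.core - z'.G n))
    have h4 := neg_frobInner_le (z'.Y n) (unfold n z'.core - z'.G n)
    have h5 : frobNorm (unfold n z'.core - z'.G n) ≤ c⁻¹ * (b n + b n) := by
      rw [h.unfold_core_sub hρ n, frobNorm_smul, abs_of_pos (inv_pos.2 hρ)]
      exact mul_le_mul (inv_anti₀ hc hρc)
        ((frobNorm_sub_le _ _).trans (add_le_add (hY' n) (hY n))) (frobNorm_nonneg _)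
        (inv_pos.2 hc).le
    have h6 := mul_le_mul (hY' n) h5 (frobNorm_nonneg _) hb
    linarith
  have h2 := Finset.sum_le_sum fun n (_ : n ∈ Finset.univ) => h1 n
  rw [Finset.sum_neg_distrib] at h2
  have h3 : -(∑ n, frobNorm (P.lap n) * √(d n)) ≤ P.h z'.U := by
    rw [Problem.h_eq, ← Finset.sum_neg_distrib]
    refine Finset.sum_le_sum fun n _ => ?_
    simpa using neg_le_frobInner_mul_of_orthonormal (P.lap n) (h.U_update n).transpose_mul_self
  have h4 := mul_le_mul_of_nonneg_left h3 (by positivity : 0 ≤ P.mu / 2)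
  have h5 := dotProduct_self_nonneg (z'.X - multiProd z'.core z'.U)
  unfold augLagrangian
  linarith

/-- Dual feasibility in the core tensor, with the old tensor `𝒳`. -/
theorem IsStep.core_stationary (h : IsStep P z z' τ) (hρ : 0 < z.rho) :
    z'.core - multiProdT z.X z'.U + ∑ n, refold n (z'.Y n) = 0 := by
  have hne : 1 + 3 * z.rho ≠ 0 := by positivity
  have h1 : ∀ n, refold n (z'.Y n)
      = z.rho • z'.core - z.rho • refold n (z'.G n - z.rho⁻¹ • z.Y n) := by
    intro n
    rw [h.Y_update n, smul_sub, refold_add, refold_sub, refold_smul, refold_unfold, refold_smul,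
      refold_sub, refold_smul, smul_sub, smul_smul, mul_inv_cancel₀ hρ.ne', one_smul]
    abel
  have h2 : (1 + 3 * z.rho) • z'.core
      = z.rho • calB z.rho z'.G z.Y + multiProdT z.X z'.U := by
    rw [h.core_update, smul_smul, mul_inv_cancel₀ hne, one_smul]
  rw [Finset.sum_congr rfl fun n _ => h1 n, Finset.sum_sub_distrib, Fin.sum_const,
    ← Finset.smul_sum]
  change _ + (_ - z.rho • calB z.rho z'.G z.Y) = 0
  have h3 : z.rho • calB z.rho z'.G z.Y = (1 + 3 * z.rho) • z'.core - multiProdT z.X z'.U := by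
    rw [h2, add_sub_cancel_right]
  rw [h3]
  module

end Step

/-! ### Limits along the iteration -/

/-- A sequence that is bounded below and decreases by `δ`, up to summable errors, converges, and
`δ` tends to zero. -/
theorem tendsto_of_quasi_descent {a e δ : ℕ → ℝ} (he : Summable e) (he0 : ∀ k, 0 ≤ e k)
    (hδ : ∀ k, 0 ≤ δ k) {b : ℝ} (hb : ∀ k, b ≤ a k) (h : ∀ k, a (k + 1) ≤ a k + e k - δ k) :
    (∃ l, Tendsto a atTop (𝓝 l)) ∧ Tendsto δ atTop (𝓝 0) := by
  have hS := he.hasSum.tendsto_sum_nat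
  have hanti : Antitone fun k => a k - ∑ j ∈ Finset.range k, e j := by
    refine antitone_nat_of_succ_le fun k => ?_
    rw [Finset.sum_range_succ]
    linarith [h k, hδ k]
  have hbdd : BddBelow (Set.range fun k => a k - ∑ j ∈ Finset.range k, e j) := by
    refine ⟨b - ∑' j, e j, ?_⟩
    rintro _ ⟨k, rfl⟩
    have := he.sum_le_tsum (Finset.range k) fun j _ => he0 j
    change b - _ ≤ a k - _
    linarith [hb k]
  have ha := (tendsto_atTop_ciInf hanti hbdd).add hS
  simp only [sub_add_cancel] at ha
  refine ⟨⟨_, ha⟩, squeeze_zero hδ (g := fun k => a k - a (k + 1) + e k)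
    (fun k => by linarith [h k]) ?_⟩
  simpa using (ha.sub ((tendsto_add_atTop_iff_nat 1).2 ha)).add he.tendsto_atTop_zero

theorem tendsto_smul_zero {α m n : Type*} {l : Filter α} {c : α → ℝ} {M : α → Matrix m n ℝ}
    {b : ℝ} (hc : ∀ k, |c k| ≤ b) (hM : Tendsto M l (𝓝 0)) :
    Tendsto (fun k => c k • M k) l (𝓝 0) := by
  refine tendsto_pi_nhds.2 fun i => tendsto_pi_nhds.2 fun j => ?_
  have h := tendsto_pi_nhds.1 (tendsto_pi_nhds.1 hM i) j
  refine squeeze_zero_norm (a := fun k => b * |M k i j|) (fun k => ?_) ?_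
  · change |c k * M k i j| ≤ _
    rw [abs_mul]
    exact mul_le_mul_of_nonneg_right (hc k) (abs_nonneg _)
  · simpa using h.abs.const_mul b

theorem exists_tendsto_of_summable_frobNorm {m n : Type*} [Fintype m] [Fintype n]
    {Y : ℕ → Matrix m n ℝ} (h : Summable fun k => frobNorm (Y (k + 1) - Y k)) :
    ∃ Y₀, Tendsto Y atTop (𝓝 Y₀) := by
  have h1 : ∀ i j, ∃ y, Tendsto (fun k => Y k i j) atTop (𝓝 y) := fun i j =>
    cauchySeq_tendsto_of_complete (cauchySeq_of_summable_dist (Summable.of_nonneg_of_le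
      (fun _ => dist_nonneg) (fun k => by
        rw [dist_comm]
        exact abs_apply_le_frobNorm (Y (k + 1) - Y k) i j) h))
  choose y hy using h1
  exact ⟨Matrix.of y, tendsto_pi_nhds.2 fun i => tendsto_pi_nhds.2 fun j => hy i j⟩

/-- The estimate behind the decrease of `‖D‖`: a monotonicity inequality with perturbations
`y₀`, `y₁` bounds `‖D₁‖² - ‖D₀‖²` linearly in the perturbations. -/
theorem frobNorm_sq_le_of_monotone {m n : Type*} [Fintype m] [Fintype n]
    {D₀ D₁ y₀ y₁ : Matrix m n ℝ} {q γ M b : ℝ} (hq : 0 ≤ q) (hqγ : q ≤ γ)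
    (h : frobInner (y₁ + D₁ - D₀) (D₁ + y₁ - q • y₀) ≤ 0)
    (hD₀ : frobNorm D₀ ≤ M) (hD₁ : frobNorm D₁ ≤ M) (hy₁ : frobNorm y₁ ≤ b) :
    frobNorm D₁ ^ 2 ≤ frobNorm D₀ ^ 2
      + (2 * (3 * M) * frobNorm y₁ + 2 * (γ * (b + 2 * M)) * frobNorm y₀) := by
  have hM : 0 ≤ M := (frobNorm_nonneg _).trans hD₀
  have n0 := frobNorm_nonneg y₀
  have n1 := frobNorm_nonneg y₁
  have h1 : -(frobNorm y₁ * M) ≤ frobInner y₁ D₁ :=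
    (neg_le_neg (mul_le_mul_of_nonneg_left hD₁ n1)).trans (neg_frobInner_le _ _)
  have h2 : frobInner y₁ D₀ ≤ frobNorm y₁ * M :=
    (frobInner_le _ _).trans (mul_le_mul_of_nonneg_left hD₀ n1)
  have h3 : frobInner (y₁ + D₁ - D₀) y₀ ≤ (b + 2 * M) * frobNorm y₀ := by
    refine (frobInner_le _ _).trans (mul_le_mul_of_nonneg_right ?_ n0)
    linarith [frobNorm_sub_le (y₁ + D₁) D₀, frobNorm_add_le y₁ D₁]
  have h4 : q * frobInner (y₁ + D₁ - D₀) y₀ ≤ γ * ((b + 2 * M) * frobNorm y₀) :=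
    (mul_le_mul_of_nonneg_left h3 hq).trans (mul_le_mul_of_nonneg_right hqγ
      (mul_nonneg (by linarith [n1.trans hy₁]) n0))
  have h5 := frobInner_self_nonneg (D₁ - D₀)
  have h6 := frobInner_self_nonneg y₁
  rw [frobNorm_sq, frobNorm_sq]
  rw [frobInner_sub_right, frobInner_smul_right] at h
  simp only [frobInner_add_left, frobInner_sub_left, frobInner_add_right, frobInner_sub_right,
    frobInner_comm D₀ D₁, frobInner_comm D₁ y₁, frobInner_comm D₀ y₁] at *
  linarith

theorem nextRho_le {γ ρ : ℝ} (hγ : 1 < γ) (hρ : 0 < ρ) (r s : ℝ) : nextRho γ ρ r s ≤ γ * ρ := by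
  unfold nextRho
  have h1 : ρ ≤ γ * ρ := le_mul_of_one_le_left hρ.le hγ.le
  split_ifs
  · exact le_rfl
  · exact (div_le_self hρ.le hγ.le).trans h1
  · exact h1

section Asymptotics

variable {I d : Fin 3 → ℕ} {P : Problem I} {γ : ℝ} {z : ℕ → Iterate I d} {τ : ℕ → Fin 3 → ℝ}

theorem IsAlgorithm2.rho_le (halg : IsAlgorithm2 P γ z τ) (hγ : 1 < γ) (k : ℕ) :
    (z (k + 2)).rho ≤ γ * (z (k + 1)).rho := by
  rw [halg.rho_update k]
  exact nextRho_le hγ (halg.rho_pos _) _ _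

theorem IsAlgorithm2.orthonormal (halg : IsAlgorithm2 P γ z τ) (k : ℕ) (n : Fin 3) :
    ((z (k + 1)).U n)ᵀ * (z (k + 1)).U n = 1 :=
  ((halg.step k).U_update n).transpose_mul_self

theorem IsAlgorithm2.X_of_mem (halg : IsAlgorithm2 P γ z τ) (k : ℕ) (i : Idx I) (hi : i ∈ P.Ω) :
    (z (k + 1)).X i = P.T i := by
  rw [(halg.step k).X_update]
  exact if_pos hi

theorem IsAlgorithm2.X_of_notMem (halg : IsAlgorithm2 P γ z τ) (k : ℕ) (i : Idx I) (hi : i ∉ P.Ω) :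
    (z (k + 1)).X i = multiProd (z (k + 1)).core (z (k + 1)).U i := by
  rw [(halg.step k).X_update]
  exact if_neg hi

theorem IsAlgorithm2.tendsto_primalRes (halg : IsAlgorithm2 P γ z τ) {c : ℝ} (hc : 0 < c)
    (hρ : ∀ k, c ≤ (z k).rho)
    (hsum : ∀ n, Summable fun k => frobNorm ((z (k + 1)).Y n - (z k).Y n)) (n : Fin 3) :
    Tendsto (fun k => frobNorm (unfold n (z (k + 1)).core - (z (k + 1)).G n)) atTop (𝓝 0) := by
  refine squeeze_zero (fun _ => frobNorm_nonneg _)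
    (g := fun k => c⁻¹ * frobNorm ((z (k + 1)).Y n - (z k).Y n)) (fun k => ?_) ?_
  · have hk := halg.rho_pos k
    rw [(halg.step k).unfold_core_sub hk, frobNorm_smul, abs_of_pos (inv_pos.2 hk)]
    exact mul_le_mul_of_nonneg_right (inv_anti₀ hc (hρ k)) (frobNorm_nonneg _)
  · simpa using (hsum n).tendsto_atTop_zero.const_mul c⁻¹

/-- Summed over all iterations, the decrease of the augmented Lagrangian is finite. -/
theorem IsAlgorithm2.tendsto_decrease (halg : IsAlgorithm2 P γ z τ) (hlam : 0 < P.lam)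
    (hmu : 0 ≤ P.mu) (hγ : 1 < γ) {c : ℝ} (hc : 0 < c) (hρ : ∀ k, c ≤ (z k).rho) {b : Fin 3 → ℝ}
    (hb : ∀ n k, frobNorm ((z k).Y n) ≤ b n)
    (hsum : ∀ n, Summable fun k => frobNorm ((z (k + 1)).Y n - (z k).Y n)) {ε : ℝ} (hε : 0 ≤ ε)
    (hL : ∀ k n, GradLipschitz P (z k) (z (k + 1)) n (τ k n - ε)) :
    Tendsto (fun k => ε / 2 * ∑ n, frobNorm ((z (k + 2)).U n - (z (k + 1)).U n) ^ 2
      + tensorNorm ((z (k + 2)).X - (z (k + 1)).X) ^ 2 / 2) atTop (𝓝 0) := by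
  have hsq : ∀ n, Summable fun k =>
      (1 + γ) / c * frobNorm ((z (k + 2)).Y n - (z (k + 1)).Y n) ^ 2 := by
    intro n
    refine Summable.mul_left _ (Summable.of_nonneg_of_le (fun _ => sq_nonneg _) (fun k => ?_)
      (((summable_nat_add_iff 1).2 (hsum n)).mul_left (b n + b n)))
    rw [sq]
    exact mul_le_mul_of_nonneg_right ((frobNorm_sub_le _ _).trans (add_le_add (hb n _) (hb n _)))
      (frobNorm_nonneg _)
  refine (tendsto_of_quasi_descent (a := fun k => augLagrangian P (z (k + 1)).rho (z (k + 1)).Y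
      (z (k + 1)).G (z (k + 1)).core (z (k + 1)).U (z (k + 1)).X)
    (e := fun k => ∑ n, (1 + γ) / c * frobNorm ((z (k + 2)).Y n - (z (k + 1)).Y n) ^ 2)
    (summable_sum fun n _ => hsq n) (fun k => ?_) (fun k => ?_)
    (b := -(∑ n, b n * (c⁻¹ * (b n + b n))) - P.mu / 2 * ∑ n, frobNorm (P.lap n) * √(d n))
    (fun k => ?_) fun k => ?_).2
  · exact Finset.sum_nonneg fun n _ => mul_nonneg (div_nonneg (by linarith) hc.le) (sq_nonneg _)
  · exact add_nonneg (mul_nonneg (by linarith) (Finset.sum_nonneg fun n _ => sq_nonneg _))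
      (by positivity)
  · exact (halg.step k).le_augLagrangian hlam hmu hc (hρ k) (halg.rho_pos _) (fun n => hb n _)
      fun n => hb n _
  · exact (halg.step (k + 1)).augLagrangian_le hlam hc hγ (hρ _) (halg.rho_le hγ k)
      (halg.orthonormal k) (halg.X_of_mem k) (hL _)

theorem tendsto_tensor_zero {J : Fin 3 → ℕ} {α : Type*} {l : Filter α} {X : α → Tensor J}
    (h : Tendsto (fun k => tensorNorm (X k)) l (𝓝 0)) : Tendsto X l (𝓝 0) := by
  have h1 : Tendsto (fun k => unfold 0 (X k)) l (𝓝 0) :=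
    tendsto_zero_of_frobNorm (by simpa only [frobNorm_unfold] using h)
  have h2 := ((continuous_refold 0).tendsto (0 : Unf J 0)).comp h1
  simp only [Function.comp_def, refold_unfold] at h2
  exact h2

theorem tendsto_zero_of_sq {α : Type*} {l : Filter α} {f : α → ℝ}
    (h : Tendsto (fun k => f k ^ 2) l (𝓝 0)) : Tendsto f l (𝓝 0) := by
  have h1 := h.sqrt
  simp only [Real.sqrt_sq_eq_abs, Real.sqrt_zero] at h1
  exact (tendsto_zero_iff_abs_tendsto_zero f).2 h1

theorem IsAlgorithm2.tendsto_X_sub (halg : IsAlgorithm2 P γ z τ) (hlam : 0 < P.lam)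
    (hmu : 0 ≤ P.mu) (hγ : 1 < γ) {c : ℝ} (hc : 0 < c) (hρ : ∀ k, c ≤ (z k).rho) {b : Fin 3 → ℝ}
    (hb : ∀ n k, frobNorm ((z k).Y n) ≤ b n)
    (hsum : ∀ n, Summable fun k => frobNorm ((z (k + 1)).Y n - (z k).Y n)) :
    Tendsto (fun k => (z (k + 1)).X - (z k).X) atTop (𝓝 0) := by
  have h := halg.tendsto_decrease hlam hmu hγ hc hρ hb hsum le_rfl
    fun k n => by simpa using (halg.step k).tau_lipschitz n
  have h1 := h.const_mul 2
  refine (tendsto_add_atTop_iff_nat 1).1 (tendsto_tensor_zero (tendsto_zero_of_sq ?_))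
  convert h1 using 2
  · ring
  · ring

theorem IsAlgorithm2.tendsto_U_sub (halg : IsAlgorithm2 P γ z τ) (hlam : 0 < P.lam)
    (hmu : 0 ≤ P.mu) (hγ : 1 < γ) {c : ℝ} (hc : 0 < c) (hρ : ∀ k, c ≤ (z k).rho) {b : Fin 3 → ℝ}
    (hb : ∀ n k, frobNorm ((z k).Y n) ≤ b n)
    (hsum : ∀ n, Summable fun k => frobNorm ((z (k + 1)).Y n - (z k).Y n)) {ε : ℝ} (hε : 0 < ε)
    (hL : ∀ k n, GradLipschitz P (z k) (z (k + 1)) n (τ k n - ε)) (n : Fin 3) :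
    Tendsto (fun k => (z (k + 1)).U n - (z k).U n) atTop (𝓝 0) := by
  have h := (halg.tendsto_decrease hlam hmu hγ hc hρ hb hsum hε.le hL).const_mul (2 / ε)
  rw [mul_zero] at h
  refine (tendsto_add_atTop_iff_nat 1).1 (tendsto_zero_of_frobNorm (tendsto_zero_of_sq
    (squeeze_zero (fun _ => sq_nonneg _) (fun k => ?_) h)))
  have h1 : frobNorm ((z (k + 2)).U n - (z (k + 1)).U n) ^ 2
      ≤ ∑ n, frobNorm ((z (k + 2)).U n - (z (k + 1)).U n) ^ 2 :=
    Finset.single_le_sum (f := fun n => frobNorm ((z (k + 2)).U n - (z (k + 1)).U n) ^ 2)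
      (fun _ _ => sq_nonneg _) (Finset.mem_univ n)
  have h2 : 0 ≤ 2 / ε * (tensorNorm ((z (k + 2)).X - (z (k + 1)).X) ^ 2 / 2) := by positivity
  have h3 : 2 / ε * (ε / 2 * ∑ n, frobNorm ((z (k + 2)).U n - (z (k + 1)).U n) ^ 2)
      = ∑ n, frobNorm ((z (k + 2)).U n - (z (k + 1)).U n) ^ 2 := by field_simp
  rw [mul_add, h3]
  exact h1.trans (le_add_of_nonneg_right h2)

/-- The gap between the multiplier and the subgradient that the proximal step provides. -/
noncomputable def dualGap (z z' : Iterate I d) : Tensor d := z.rho • (z.core - z'.core)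

theorem IsStep.shifted_multiplier {z z' : Iterate I d} {t : Fin 3 → ℝ} (h : IsStep P z z' t)
    (n : Fin 3) : z.Y n + z.rho • (unfold n z.core - z'.G n)
      = z'.Y n + unfold n (dualGap z z') := by
  rw [h.Y_update n, dualGap, unfold_smul, unfold_sub]
  module

theorem IsStep.isSubgradient_dualGap {z z' : Iterate I d} {t : Fin 3 → ℝ} (h : IsStep P z z' t)
    (hlam : 0 < P.lam) (hρ : 0 < z.rho) (n : Fin 3) :
    IsSubgradient (fun Z => traceNorm Z / (3 * P.lam)) (z'.G n)
      (z'.Y n + unfold n (dualGap z z')) := by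
  rw [← h.shifted_multiplier]
  exact h.isSubgradient hlam hρ n

theorem IsStep.frobNorm_dualGap_le {z z' : Iterate I d} {t : Fin 3 → ℝ} (h : IsStep P z z' t)
    (hlam : 0 < P.lam) (hρ : 0 < z.rho) (n : Fin 3) :
    frobNorm (unfold n (dualGap z z'))
      ≤ (3 * P.lam)⁻¹ * √(Fintype.card (ColIdx d n)) + frobNorm (z'.Y n) := by
  obtain ⟨K, hK, -, he⟩ := h.exists_contraction hlam hρ n
  rw [h.shifted_multiplier] at he
  rw [← add_sub_cancel_left (z'.Y n) (unfold n (dualGap z z')), he]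
  refine (frobNorm_sub_le _ _).trans (add_le_add_left ?_ _)
  rw [frobNorm_smul, abs_of_pos (by positivity)]
  exact mul_le_mul_of_nonneg_left hK.frobNorm_le (by positivity)

/-- If the primal residuals tend to zero and the dual residuals stay away from zero, then the
penalty parameter is eventually divided by `γ` in every iteration. -/
theorem IsAlgorithm2.false_of_dualRes_ge (halg : IsAlgorithm2 P γ z τ) (hγ : 1 < γ) {c : ℝ}
    (hc : 0 < c) (hρ : ∀ k, c ≤ (z k).rho) {η : ℝ} (hη : 0 < η)
    (hr : ∀ n, Tendsto (fun k => frobNorm (unfold n (z (k + 1)).core - (z (k + 1)).G n)) atTop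
      (𝓝 0))
    (hs : ∀ᶠ k in atTop, η ≤ dualRes (z k) (z (k + 1))) : False := by
  have hγ0 : 0 < γ := zero_lt_one.trans hγ
  have hr' : ∀ᶠ k in atTop, ∀ n,
      frobNorm (unfold n (z (k + 1)).core - (z (k + 1)).G n) < η / 10 :=
    eventually_all.2 fun n => (hr n).eventually_lt_const (by positivity)
  obtain ⟨K, hK⟩ := eventually_atTop.1 (hr'.and hs)
  have hdiv : ∀ k, K ≤ k → (z (k + 2)).rho = (z (k + 1)).rho / γ := by
    intro k hk
    obtain ⟨h1, h2⟩ := hK k hk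
    have h3 : primalRes (z (k + 1)) < η / 10 := max_lt (h1 0) (max_lt (h1 1) (h1 2))
    rw [halg.rho_update k, nextRho, if_neg (by linarith), if_pos (by linarith)]
  have hpow : ∀ j, (z (K + j + 1)).rho = (z (K + 1)).rho / γ ^ j := by
    intro j
    induction j with
    | zero => simp
    | succ j ih =>
      rw [show K + (j + 1) + 1 = K + j + 2 by ring, hdiv _ (Nat.le_add_right _ _), ih, pow_succ,
        div_div]
  have hlim : Tendsto (fun j : ℕ => (z (K + 1)).rho / γ ^ j) atTop (𝓝 0) :=
    tendsto_const_nhds.div_atTop (tendsto_pow_atTop_atTop_of_one_lt hγ)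
  have : c ≤ 0 := ge_of_tendsto' hlim fun j => (hpow j) ▸ hρ _
  linarith

/-- By monotonicity of the subdifferential the norm of the dual gap decreases up to summable
errors, so that it converges.  A nonzero limit would make the rule for the penalty parameter divide
it by `γ` forever. -/
theorem IsAlgorithm2.tendsto_dualGap (halg : IsAlgorithm2 P γ z τ) (hlam : 0 < P.lam)
    (hγ : 1 < γ) {c : ℝ} (hc : 0 < c) (hρ : ∀ k, c ≤ (z k).rho) {b : Fin 3 → ℝ}
    (hb : ∀ n k, frobNorm ((z k).Y n) ≤ b n)
    (hsum : ∀ n, Summable fun k => frobNorm ((z (k + 1)).Y n - (z k).Y n)) :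
    Tendsto (fun k => dualGap (z k) (z (k + 1))) atTop (𝓝 0) := by
  set M := (3 * P.lam)⁻¹ * √(Fintype.card (ColIdx d 0)) + b 0
  have hM : ∀ k, frobNorm (unfold 0 (dualGap (z k) (z (k + 1)))) ≤ M := fun k =>
    ((halg.step k).frobNorm_dualGap_le hlam (halg.rho_pos k) 0).trans
      (add_le_add_right (hb 0 (k + 1)) _)
  have hM0 : 0 ≤ M := (frobNorm_nonneg _).trans (hM 0)
  have hb0 : 0 ≤ b 0 := (frobNorm_nonneg _).trans (hb 0 0)
  have hy : ∀ k, frobNorm ((z (k + 1)).Y 0 - (z k).Y 0) ≤ b 0 + b 0 := fun k =>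
    (frobNorm_sub_le _ _).trans (add_le_add (hb 0 _) (hb 0 _))
  -- The ratio of consecutive penalty parameters is bounded only from the second iteration on.
  have hmono : ∀ k, frobNorm (unfold 0 (dualGap (z (k + 2)) (z (k + 3)))) ^ 2
      ≤ frobNorm (unfold 0 (dualGap (z (k + 1)) (z (k + 2)))) ^ 2
        + (2 * (3 * M) * frobNorm ((z (k + 3)).Y 0 - (z (k + 2)).Y 0)
          + 2 * (γ * (b 0 + b 0 + 2 * M)) * frobNorm ((z (k + 2)).Y 0 - (z (k + 1)).Y 0)) := by
    intro k
    have hρ1 := halg.rho_pos (k + 1)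
    have hρ2 := halg.rho_pos (k + 2)
    refine frobNorm_sq_le_of_monotone (q := (z (k + 2)).rho / (z (k + 1)).rho)
      (div_nonneg hρ2.le hρ1.le) ((div_le_iff₀ hρ1).2 (halg.rho_le hγ k)) ?_ (hM _) (hM _) (hy _)
    have h1 := ((halg.step (k + 1)).isSubgradient_dualGap hlam hρ1 0).monotone
      ((halg.step (k + 2)).isSubgradient_dualGap hlam hρ2 0)
    have h2 := (halg.step (k + 1)).unfold_core_sub hρ1 0
    have h3 := (halg.step (k + 2)).unfold_core_sub hρ2 0
    have e1 : (z (k + 2 + 1)).G 0 - (z (k + 1 + 1)).G 0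
        = (-(z (k + 2)).rho⁻¹) • (unfold 0 (dualGap (z (k + 2)) (z (k + 3)))
          + ((z (k + 3)).Y 0 - (z (k + 2)).Y 0)
          - ((z (k + 2)).rho / (z (k + 1)).rho) • ((z (k + 2)).Y 0 - (z (k + 1)).Y 0)) := by
      rw [eq_sub_iff_add_eq.2 (sub_eq_iff_eq_add'.1 h2).symm,
        eq_sub_iff_add_eq.2 (sub_eq_iff_eq_add'.1 h3).symm, dualGap, unfold_smul, unfold_sub]
      match_scalars <;> field_simp
      ring
    have e2 : (z (k + 2 + 1)).Y 0 + unfold 0 (dualGap (z (k + 2)) (z (k + 2 + 1)))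
        - ((z (k + 1 + 1)).Y 0 + unfold 0 (dualGap (z (k + 1)) (z (k + 1 + 1))))
        = (z (k + 3)).Y 0 - (z (k + 2)).Y 0 + unfold 0 (dualGap (z (k + 2)) (z (k + 3)))
          - unfold 0 (dualGap (z (k + 1)) (z (k + 2))) := by
      abel
    rw [e1, e2, frobInner_smul_right, neg_mul, neg_nonneg] at h1
    exact nonpos_of_mul_nonpos_right h1 (inv_pos.2 hρ2)
  have he : Summable fun k => 2 * (3 * M) * frobNorm ((z (k + 3)).Y 0 - (z (k + 2)).Y 0)
      + 2 * (γ * (b 0 + b 0 + 2 * M)) * frobNorm ((z (k + 2)).Y 0 - (z (k + 1)).Y 0) :=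
    (((summable_nat_add_iff 2).2 (hsum 0)).mul_left _).add
      (((summable_nat_add_iff 1).2 (hsum 0)).mul_left _)
  have hγ0 : 0 < γ := zero_lt_one.trans hγ
  obtain ⟨l, hl⟩ := (tendsto_of_quasi_descent (δ := fun _ => 0)
    (a := fun k => frobNorm (unfold 0 (dualGap (z (k + 1)) (z (k + 2)))) ^ 2) he
    (fun k => add_nonneg (mul_nonneg (by positivity) (frobNorm_nonneg _))
      (mul_nonneg (by positivity) (frobNorm_nonneg _)))
    (fun _ => le_rfl) (fun k => sq_nonneg _) fun k => by simpa using hmono k).1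
  have hl' := (tendsto_add_atTop_iff_nat
    (f := fun k => frobNorm (unfold 0 (dualGap (z k) (z (k + 1)))) ^ 2) 1).1 hl
  simp only [frobNorm_unfold] at hl'
  have hl0 : 0 ≤ l := ge_of_tendsto' hl' fun k => sq_nonneg _
  rcases hl0.eq_or_lt with h0 | hpos
  · rw [← h0] at hl'
    exact tendsto_tensor_zero (tendsto_zero_of_sq hl')
  · exfalso
    refine halg.false_of_dualRes_ge hγ hc hρ (η := √(l / 2)) (Real.sqrt_pos.2 (by positivity))
      (halg.tendsto_primalRes hc hρ hsum) ?_
    filter_upwards [hl'.eventually_const_lt (half_lt_self hpos)] with k hk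
    have h1 : dualGap (z k) (z (k + 1)) = (-(z k).rho) • ((z (k + 1)).core - (z k).core) := by
      rw [dualGap]
      module
    have h2 : tensorNorm (dualGap (z k) (z (k + 1)))
        = (z k).rho * tensorNorm ((z (k + 1)).core - (z k).core) := by
      rw [h1, ← frobNorm_unfold 0, unfold_smul, frobNorm_smul, frobNorm_unfold, abs_neg,
        abs_of_pos (halg.rho_pos k)]
    refine le_trans ?_ (le_max_left _ _)
    rw [← h2]
    exact Real.sqrt_le_iff.2 ⟨Real.sqrt_nonneg _, hk.le⟩

end Asymptotics

/-! ### Accumulation points -/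

section Accumulation

variable {I d : Fin 3 → ℕ} {P : Problem I} {γ : ℝ} {z : ℕ → Iterate I d} {τ : ℕ → Fin 3 → ℝ}

/-- The polar form of the orthonormalization, written for the residual
`E = τ (U - U') - ∇ℱ(U)`: it lies in the range of `U'`, with a symmetric coefficient matrix. -/
theorem IsStep.polar {z z' : Iterate I d} {t : Fin 3 → ℝ} (h : IsStep P z z' t) (hρ : 0 < z.rho)
    (n : Fin 3) {E : Matrix (Fin (I n)) (Fin (d n)) ℝ}
    (hE : E = t n • (z.U n - z'.U n) - explicitGrad P z.rho z.X (calB z.rho z'.G z.Y)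
      (currentFactors n z.U z'.U) n (z.U n)) :
    E = z'.U n * ((z'.U n)ᵀ * E) ∧ ((z'.U n)ᵀ * E)ᵀ = (z'.U n)ᵀ * E := by
  have hne : (1 + 3 * z.rho) ≠ 0 := by positivity
  have hort := h.U_update n
  have hU := hort.transpose_mul_self
  obtain ⟨h1, h2⟩ := hort.polar
  rw [ortArg_eq P z z' hρ] at h1 h2
  have hN : t n • z.U n - explicitGrad P z.rho z.X (calB z.rho z'.G z.Y)
      (currentFactors n z.U z'.U) n (z.U n) = E + t n • z'.U n := by
    rw [hE]
    module
  rw [hN] at h1 h2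
  simp only [Matrix.mul_smul, Matrix.transpose_smul] at h1 h2
  have h3 := smul_right_injective _ hne h1
  have h4 := smul_right_injective _ hne h2
  simp only [Matrix.mul_add, Matrix.mul_smul, hU, Matrix.transpose_add, Matrix.transpose_smul,
    Matrix.transpose_one, Matrix.mul_one] at h3 h4
  exact ⟨add_right_cancel h3, add_right_cancel h4⟩

theorem tendsto_matrix_mul {α m n r : Type*} [Fintype n] {l : Filter α} {A : α → Matrix m n ℝ}
    {B : α → Matrix n r ℝ} {A₀ : Matrix m n ℝ} {B₀ : Matrix n r ℝ} (hA : Tendsto A l (𝓝 A₀))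
    (hB : Tendsto B l (𝓝 B₀)) : Tendsto (fun k => A k * B k) l (𝓝 (A₀ * B₀)) :=
  ((continuous_fst.matrix_mul continuous_snd).tendsto (A₀, B₀)).comp (hA.prodMk_nhds hB)

theorem tendsto_matrix_transpose {α m n : Type*} {l : Filter α} {A : α → Matrix m n ℝ}
    {A₀ : Matrix m n ℝ} (hA : Tendsto A l (𝓝 A₀)) : Tendsto (fun k => (A k)ᵀ) l (𝓝 A₀ᵀ) :=
  ((continuous_id.matrix_transpose).tendsto A₀).comp hA

/-- The conclusion of `IsStep.polar` is a closed condition. -/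
theorem polar_of_tendsto {α m n : Type*} [Fintype m] [Fintype n] {l : Filter α} [l.NeBot]
    {Q E : α → Matrix m n ℝ} {Q₀ E₀ : Matrix m n ℝ} (hQ : Tendsto Q l (𝓝 Q₀))
    (hE : Tendsto E l (𝓝 E₀))
    (h : ∀ k, E k = Q k * ((Q k)ᵀ * E k) ∧ ((Q k)ᵀ * E k)ᵀ = (Q k)ᵀ * E k) :
    E₀ = Q₀ * (Q₀ᵀ * E₀) ∧ (Q₀ᵀ * E₀)ᵀ = Q₀ᵀ * E₀ := by
  have hS := tendsto_matrix_mul (tendsto_matrix_transpose hQ) hE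
  exact ⟨tendsto_nhds_unique (hE.congr fun k => (h k).1) (tendsto_matrix_mul hQ hS),
    tendsto_nhds_unique (tendsto_matrix_transpose hS) (hS.congr fun k => (h k).2.symm)⟩

theorem IsAlgorithm2.orthonormal_of_tendsto (halg : IsAlgorithm2 P γ z τ) {l : Filter ℕ} [l.NeBot]
    {U : Factors I d} (hU : Tendsto (fun k => (z (k + 1)).U) l (𝓝 U)) (n : Fin 3) :
    (U n)ᵀ * U n = 1 := by
  have hn := tendsto_pi_nhds.1 hU n
  exact tendsto_nhds_unique (tendsto_matrix_mul (tendsto_matrix_transpose hn) hn)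
    (tendsto_const_nhds.congr fun k => (halg.orthonormal k n).symm)

theorem continuous_partialProj (n : Fin 3) :
    Continuous fun p : Tensor I × Factors I d => partialProj n p.1 p.2 :=
  ((continuous_unfold n).comp continuous_fst).matrix_mul ((continuous_kron n).comp continuous_snd)

/-- Along a filter on which two consecutive iterates have the same limit, the gradient of
`factorCost` tends to the gradient of the objective at orthonormal factors, up to the part that a
symmetric multiplier absorbs. -/
theorem IsAlgorithm2.tendsto_explicitGrad (halg : IsAlgorithm2 P γ z τ) {l : Filter ℕ}
    {C : Tensor d} {U : Factors I d} {X : Tensor I}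
    (hC : Tendsto (fun k => (z (k + 1)).core) l (𝓝 C))
    (hU' : Tendsto (fun k => (z (k + 1)).U) l (𝓝 U)) (hU : Tendsto (fun k => (z k).U) l (𝓝 U))
    (hX : Tendsto (fun k => (z k).X) l (𝓝 X)) (n : Fin 3) :
    Tendsto (fun k => explicitGrad P (z k).rho (z k).X
        (calB (z k).rho (z (k + 1)).G (z k).Y) (currentFactors n (z k).U (z (k + 1)).U) n
        ((z k).U n)) l
      (𝓝 (-(partialProj n X U * (unfold n C)ᵀ)
        + (P.mu / 2) • ((P.lap n + (P.lap n)ᵀ) * U n))) := by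
  have hV : Tendsto (fun k => currentFactors n (z k).U (z (k + 1)).U) l (𝓝 U) := by
    refine tendsto_pi_nhds.2 fun m => ?_
    by_cases hm : m < n
    · simpa only [currentFactors, if_pos hm] using tendsto_pi_nhds.1 hU' m
    · simpa only [currentFactors, if_neg hm] using tendsto_pi_nhds.1 hU m
  have hUn := tendsto_pi_nhds.1 hU n
  have hM := ((continuous_partialProj n).tendsto (X, U)).comp (hX.prodMk_nhds hV)
  have hA := tendsto_multiProdT hX hV
  have hA' := tendsto_multiProdT hX hU'
  have hdiff := ((continuous_unfold n).tendsto _).comp (hA.sub hA')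
  rw [sub_self] at hdiff
  have hsmall := tendsto_smul_zero (c := fun k => (1 + 3 * (z k).rho)⁻¹) (b := 1) (fun k => by
    have hk := halg.rho_pos k
    rw [abs_of_pos (by positivity)]
    exact inv_le_one_of_one_le₀ (by linarith)) hdiff
  have hN := (((continuous_unfold n).tendsto C).comp hC).add hsmall
  rw [add_zero] at hN
  have hmain := (tendsto_matrix_mul hM (tendsto_matrix_transpose hN)).neg.add
    ((tendsto_matrix_mul (tendsto_const_nhds (x := P.lap n + (P.lap n)ᵀ)) hUn).const_smul
      (P.mu / 2))
  have key : ∀ k, explicitGrad P (z k).rho (z k).X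
        (calB (z k).rho (z (k + 1)).G (z k).Y) (currentFactors n (z k).U (z (k + 1)).U) n
        ((z k).U n)
      = -(partialProj n (z k).X (currentFactors n (z k).U (z (k + 1)).U)
          * (unfold n (z (k + 1)).core + (1 + 3 * (z k).rho)⁻¹ • unfold n
            (multiProdT (z k).X (currentFactors n (z k).U (z (k + 1)).U)
              - multiProdT (z k).X (z (k + 1)).U))ᵀ)
        + (P.mu / 2) • ((P.lap n + (P.lap n)ᵀ) * (z k).U n) := by
    intro k
    rw [explicitGrad, ← Matrix.mul_smul, ← Matrix.transpose_smul]
    congr 4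
    rw [(halg.step k).core_update, unfold_smul, unfold_add, unfold_sub, ← smul_add,
      unfold_multiProdT n (z k).X (currentFactors n (z k).U (z (k + 1)).U), currentFactors_self,
      unfold_smul]
    congr 1
    abel
  simp only [key]
  exact hmain

/-- The residual `X - C ×₁ U ×₂ V ×₃ W` contributes `X` minus a symmetric multiple of the
factor. -/
theorem unfold_residual_mul (X : Tensor I) (C : Tensor d) {U : Factors I d}
    (hU : ∀ m, (U m)ᵀ * U m = 1) (n : Fin 3) :
    unfold n (X - multiProd C U) * kron n U * (unfold n C)ᵀ
      = partialProj n X U * (unfold n C)ᵀ - U n * (unfold n C * (unfold n C)ᵀ) := by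
  rw [unfold_sub, unfold_multiProd, Matrix.sub_mul, Matrix.sub_mul, Matrix.mul_assoc (U n * _),
    kron_transpose_mul_self n hU, Matrix.mul_one, Matrix.mul_assoc (U n)]
  rfl

theorem IsAlgorithm2.isKKT_of_tendsto (halg : IsAlgorithm2 P γ z τ) (hlam : 0 < P.lam)
    (hmu : 0 ≤ P.mu) (hγ : 1 < γ) {c : ℝ} (hc : 0 < c) (hρ : ∀ k, c ≤ (z k).rho) {b : Fin 3 → ℝ}
    (hb : ∀ n k, frobNorm ((z k).Y n) ≤ b n)
    (hsum : ∀ n, Summable fun k => frobNorm ((z (k + 1)).Y n - (z k).Y n))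
    {l : Filter ℕ} [l.NeBot] (hl : l ≤ atTop) {G : ∀ n, Unf d n} {C : Tensor d} {U : Factors I d}
    {X : Tensor I} (hG : ∀ n, Tendsto (fun k => (z (k + 1)).G n) l (𝓝 (G n)))
    (hC : Tendsto (fun k => (z (k + 1)).core) l (𝓝 C))
    (hU : Tendsto (fun k => (z (k + 1)).U) l (𝓝 U))
    (hX : Tendsto (fun k => (z (k + 1)).X) l (𝓝 X)) : IsKKT P (G, C, U, X) := by
  have hXold : Tendsto (fun k => (z k).X) l (𝓝 X) := by
    simpa using hX.sub ((halg.tendsto_X_sub hlam hmu hγ hc hρ hb hsum).mono_left hl)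
  refine ⟨fun i hi => ?_, fun n => ?_, halg.orthonormal_of_tendsto hU, fun i hi => ?_, ?_⟩
  · exact tendsto_nhds_unique (tendsto_pi_nhds.1 hX i)
      (tendsto_const_nhds.congr fun k => (halg.X_of_mem k i hi).symm)
  · have h1 : Tendsto (fun k => unfold n (z (k + 1)).core) l (𝓝 (unfold n C)) :=
      ((continuous_unfold n).tendsto C).comp hC
    have h2 : Tendsto (fun k => unfold n (z (k + 1)).core - (z (k + 1)).G n) l (𝓝 0) :=
      tendsto_zero_of_frobNorm ((halg.tendsto_primalRes hc hρ hsum n).mono_left hl)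
    have h3 := h1.sub h2
    simp only [sub_sub_cancel, sub_zero] at h3
    exact tendsto_nhds_unique (hG n) h3
  · have h1 : Tendsto (fun k => multiProd (z (k + 1)).core (z (k + 1)).U) l (𝓝 (multiProd C U)) :=
      tendsto_multiProd hC hU
    have h2 := tendsto_pi_nhds.1 h1 i
    have h3 := tendsto_pi_nhds.1 hX i
    simp only [halg.X_of_notMem _ i hi] at h3
    exact tendsto_nhds_unique h3 h2
  · choose Y hY using fun n =>
      exists_tendsto_of_summable_frobNorm (Y := fun k => (z k).Y n) (hsum n)
    have hY' : ∀ n, Tendsto (fun k => (z (k + 1)).Y n) l (𝓝 (Y n)) := fun n =>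
      ((tendsto_add_atTop_iff_nat (f := fun k => (z k).Y n) 1).2 (hY n)).mono_left hl
    have hD := (halg.tendsto_dualGap hlam hγ hc hρ hb hsum).mono_left hl
    refine ⟨Y, fun n => ?_, ?_⟩
    · have h1 : Tendsto (fun k => (z (k + 1)).Y n + unfold n (dualGap (z k) (z (k + 1)))) l
          (𝓝 (Y n + unfold n 0)) :=
        (hY' n).add (((continuous_unfold n).tendsto (0 : Tensor d)).comp hD)
      rw [show unfold n (0 : Tensor d) = 0 from rfl, add_zero] at h1
      have h2 : ∀ k, IsSubgradient (fun Z => traceNorm Z / (3 * P.lam)) ((z (k + 1)).G n)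
          ((z (k + 1)).Y n + unfold n (dualGap (z k) (z (k + 1)))) := fun k =>
        (halg.step k).isSubgradient_dualGap hlam (halg.rho_pos k) n
      exact IsSubgradient.of_tendsto (exists_isSubgradient (by positivity) _)
        (Eventually.of_forall h2) (hG n) h1
    · have h1 : Tendsto (fun k => multiProdT (z k).X (z (k + 1)).U) l (𝓝 (multiProdT X U)) :=
        tendsto_multiProdT hXold hU
      have h2 : Tendsto (fun k => ∑ n, refold n ((z (k + 1)).Y n)) l (𝓝 (∑ n, refold n (Y n))) :=
        tendsto_finsetSum Finset.univ fun n _ =>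
          ((continuous_refold n).tendsto (Y n)).comp (hY' n)
      have h3 : ∀ k, (z (k + 1)).core - multiProdT (z k).X (z (k + 1)).U
          + ∑ n, refold n ((z (k + 1)).Y n) = 0 := fun k =>
        (halg.step k).core_stationary (halg.rho_pos k)
      have h4 := (hC.sub h1).add h2
      simp only [h3] at h4
      exact tendsto_nhds_unique h4 tendsto_const_nhds

theorem IsAlgorithm2.isFactorStationary_of_tendsto (halg : IsAlgorithm2 P γ z τ)
    (hlam : 0 < P.lam) (hmu : 0 ≤ P.mu) (hγ : 1 < γ) {c : ℝ} (hc : 0 < c)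
    (hρ : ∀ k, c ≤ (z k).rho) {b : Fin 3 → ℝ} (hb : ∀ n k, frobNorm ((z k).Y n) ≤ b n)
    (hsum : ∀ n, Summable fun k => frobNorm ((z (k + 1)).Y n - (z k).Y n))
    {l : Filter ℕ} [l.NeBot] (hl : l ≤ atTop) {G : ∀ n, Unf d n} {C : Tensor d} {U : Factors I d}
    {X : Tensor I} (hC : Tendsto (fun k => (z (k + 1)).core) l (𝓝 C))
    (hU : Tendsto (fun k => (z (k + 1)).U) l (𝓝 U))
    (hX : Tendsto (fun k => (z (k + 1)).X) l (𝓝 X)) {ε : ℝ} (hε : 0 < ε) {T : ℝ}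
    (hT : ∀ k n, τ k n ≤ T)
    (hL : ∀ k n, GradLipschitz P (z k) (z (k + 1)) n (τ k n - ε)) (n : Fin 3) :
    IsFactorStationary P (G, C, U, X) n := by
  have hXold : Tendsto (fun k => (z k).X) l (𝓝 X) := by
    simpa using hX.sub ((halg.tendsto_X_sub hlam hmu hγ hc hρ hb hsum).mono_left hl)
  have hUn := fun n => tendsto_pi_nhds.1 hU n
  have hUdiff := fun m => (halg.tendsto_U_sub hlam hmu hγ hc hρ hb hsum hε hL m).mono_left hl
  have hUold : Tendsto (fun k => (z k).U) l (𝓝 U) :=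
    tendsto_pi_nhds.2 fun m => by simpa using (hUn m).sub (hUdiff m)
  have hgrad := halg.tendsto_explicitGrad hC hU hUold hXold n
  have hτ : Tendsto (fun k => τ k n • ((z k).U n - (z (k + 1)).U n)) l (𝓝 0) := by
    refine tendsto_smul_zero (b := T) (fun k => ?_) (by simpa using (hUdiff n).neg)
    rw [abs_of_pos ((halg.step k).tau_pos n)]
    exact hT k n
  have hE := hτ.sub hgrad
  rw [zero_sub] at hE
  set g := -(partialProj n X U * (unfold n C)ᵀ)
      + (P.mu / 2) • ((P.lap n + (P.lap n)ᵀ) * U n) with hg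
  obtain ⟨h1, h2⟩ := polar_of_tendsto (hUn n) hE
    fun k => (halg.step k).polar (halg.rho_pos k) n rfl
  -- The part `C₍ₙ₎ C₍ₙ₎ᵀ` comes from the residual in the gradient of the objective.
  refine ⟨(U n)ᵀ * (-g) - unfold n C * (unfold n C)ᵀ, ?_, ?_⟩
  · rw [Matrix.transpose_sub, Matrix.transpose_mul (unfold n C), Matrix.transpose_transpose, h2]
  · rw [unfold_residual_mul X C (halg.orthonormal_of_tendsto hU), Matrix.mul_sub, ← h1, hg]
    abel

end Accumulation

end Groid

theorem theorem5 {I d : Fin 3 → ℕ} (P : Groid.Problem I)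
    (hlam : 0 < P.lam) (hmu : 0 ≤ P.mu) (γ : ℝ) (hγ : 1 < γ)
    (z : ℕ → Groid.Iterate I d) (τ : ℕ → Fin 3 → ℝ)
    (halg : Groid.IsAlgorithm2 P γ z τ)
    (hrho : ∃ c : ℝ, 0 < c ∧ ∀ k, c ≤ (z k).rho)
    (hbdd : ∀ n, ∃ C : ℝ, ∀ k, Groid.frobNorm ((z k).Y n) ≤ C)
    (hsum : ∀ n, Summable fun k => Groid.frobNorm ((z (k + 1)).Y n - (z k).Y n))
    (p : Groid.Primal I d)
    (hp : MapClusterPt p Filter.atTop fun k => (z k).primal) :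
    Groid.IsKKT P p ∧
      ((∃ ε : ℝ, 0 < ε ∧ ∃ C : ℝ, ∀ k n, τ k n ≤ C ∧
          Groid.GradLipschitz P (z k) (z (k + 1)) n (τ k n - ε)) →
        ∀ n, Groid.IsFactorStationary P p n) := by
  obtain ⟨c, hc, hρ⟩ := hrho
  choose b hb using hbdd
  obtain ⟨G, C, U, X⟩ := p
  -- The iterates from the first one on have the same accumulation points, and all of them have
  -- orthonormal factors and satisfy the constraint on `Ω`.
  have hp' : MapClusterPt (G, C, U, X) Filter.atTop fun k => (z (k + 1)).primal := by
    have h : Filter.map (fun k => (z (k + 1)).primal) Filter.atTop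
        = Filter.map (fun k => (z k).primal) Filter.atTop := by
      conv_rhs => rw [← Filter.map_add_atTop_eq_nat 1, Filter.map_map]
      rfl
    rwa [MapClusterPt, h]
  obtain ⟨l, hl, hlim⟩ := mapClusterPt_iff_ultrafilter.1 hp'
  obtain ⟨hG, hlim⟩ := Prod.tendsto_iff _ _ |>.1 hlim
  obtain ⟨hC, hlim⟩ := Prod.tendsto_iff _ _ |>.1 hlim
  obtain ⟨hU, hX⟩ := Prod.tendsto_iff _ _ |>.1 hlim
  refine ⟨halg.isKKT_of_tendsto hlam hmu hγ hc hρ hb hsum hl (tendsto_pi_nhds.1 hG) hC hU hX, ?_⟩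
  rintro ⟨ε, hε, T, hT⟩ n
  exact halg.isFactorStationary_of_tendsto hlam hmu hγ hc hρ hb hsum hl hC hU hX hε
    (fun k m => (hT k m).1) (fun k m => (hT k m).2) n
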